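/- An \emph{arrangement of pseudocircles} is a finite family of simple closed curves on the sphere (or in the plane) such that any two of the curves have at most two points in common; it is \emph{simple} if no three of the curves have a common point. The \emph{vertices} of an arrangement are the intersection points of its curves, and its \emph{edges} are the pieces into which the vertices subdivide the curves; these form the \emph{arrangement graph}. The \emph{faces} (cells) are the connected components of the complement of the union of all curves; a face is a \emph{$k$-gon} (triangle for $k=3$, pentagon for $k=5$) if its boundary is a cycle of $k$ vertices and $k$ edges, and an edge is \emph{incident} to a face if it lies on the boundary of the face. The arrangement is \emph{$\triangle$-saturated} if every edge is incident to exactly one triangular face. Let $\mathcal{A}$ be a simple $\triangle$-saturated arrangement of pseudocircles with a pentagonal cell $P$. Let $p_0,\dots,p_4$ be the vertices of $P$ in cyclic order, let $T_j$ be the triangular face incident to the edge $p_jp_{j+1}$ of $P$ (indices modulo $5$), and let $q_j$ be the third vertex of $T_j$. A \emph{corona extension} $\mathcal{A}^+$ of $\mathcal{A}$ at $P$ is an arrangement of pseudocircles that consists of $\mathcal{A}$ and one additional pseudocircle $\gamma$, where $\gamma$ encloses $P$ (one side of $\gamma$ contains the closure of $P$ and no vertices of $\mathcal{A}$ other than $p_0,\dots,p_4$),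 intersects only pseudocircles that bound $P$, and meets these in exactly ten points: going once around $P$, it crosses one after the other, for $j=0,\dots,4$, the edges $p_jq_j$ and $p_{j+1}q_j$ of $T_j$, each once and in an interior point, running inside $T_j$ between these two crossings and inside a non-triangular face between the crossing with $p_{j+1}q_j$ and the crossing with $p_{j+1}q_{j+1}$. Then the arrangement graph of every corona extension $\mathcal{A}^+$ of $\mathcal{A}$ at $P$ has chromatic number exactly $4$. -/

import Mathlib

open Set

/-- The surfaces that carry the arrangements: the two-dimensional sphere and the plane. -/
def IsSphereOrPlane (X : Type*) [TopologicalSpace X] : Prop :=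
  Nonempty (X ≃ₜ Metric.sphere (0 : EuclideanSpace ℝ (Fin 3)) 1) ∨
    Nonempty (X ≃ₜ EuclideanSpace ℝ (Fin 2))

/-- The closed arc of the circle `ℝ / ℤ` that runs from `s` to `t` in the positive direction
(the whole circle if `s = t`). -/
def closedArc (s t : UnitAddCircle) : Set UnitAddCircle := {x | btw s x t}

/-- The open arc of the circle `ℝ / ℤ` that runs from `s` to `t` in the positive direction
(the circle without `s` if `s = t`). -/
def openArc (s t : UnitAddCircle) : Set UnitAddCircle := {x | btw s x t ∧ x ≠ s ∧ x ≠ t}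

/-- An arrangement of pseudocircles in `X`: a family of simple closed curves, given by
parametrizations over the circle `ℝ / ℤ`, any two of which have at most two common points. -/
structure PseudocircleArrangement (X : Type*) [TopologicalSpace X] (ι : Type*) where
  curve : ι → UnitAddCircle → X
  continuous_curve : ∀ i, Continuous (curve i)
  injective_curve : ∀ i, Function.Injective (curve i)
  inter_le_two : ∀ i j, i ≠ j → (range (curve i) ∩ range (curve j)).encard ≤ 2

namespace PseudocircleArrangement

variable {X : Type*} [TopologicalSpace X] {ι : Type*} (A : PseudocircleArrangement X ι)

/-- An arrangement is simple if no three of its pseudocircles have a common point. -/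
def IsSimple : Prop :=
  ∀ i j k, i ≠ j → j ≠ k → i ≠ k →
    range (A.curve i) ∩ range (A.curve j) ∩ range (A.curve k) = ∅

/-- The union of all pseudocircles. -/
def support : Set X := ⋃ i, range (A.curve i)

/-- The vertices of the arrangement: the intersection points of its pseudocircles. -/
def vertices : Set X := {x | ∃ i j, i ≠ j ∧ x ∈ range (A.curve i) ∩ range (A.curve j)}

/-- The edges of the arrangement: the pieces into which the vertices subdivide the
pseudocircles.  An edge is a piece of one pseudocircle that runs, in the direction of the
parametrization, from a vertex to the next vertex. -/
@[ext]
structure Edge where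
  idx : ι
  src : UnitAddCircle
  tgt : UnitAddCircle
  src_mem : A.curve idx src ∈ A.vertices
  tgt_mem : A.curve idx tgt ∈ A.vertices
  interior_notMem : ∀ x ∈ openArc src tgt, A.curve idx x ∉ A.vertices

variable {A} in
/-- The edge without its two endpoints, as a set of points. -/
def Edge.openCarrier (e : A.Edge) : Set X := A.curve e.idx '' openArc e.src e.tgt

variable {A} in
/-- The edge together with its two endpoints, as a set of points. -/
def Edge.closedCarrier (e : A.Edge) : Set X := A.curve e.idx '' closedArc e.src e.tgt

variable {A} in
/-- The (undirected) edge `e` has the endpoints `u` and `v`. -/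
def Edge.Joins (e : A.Edge) (u v : X) : Prop :=
  (A.curve e.idx e.src = u ∧ A.curve e.idx e.tgt = v) ∨
    (A.curve e.idx e.src = v ∧ A.curve e.idx e.tgt = u)

/-- The arrangement graph. -/
def graph : SimpleGraph A.vertices where
  Adj u v := u ≠ v ∧ ∃ e : A.Edge, e.Joins u v
  symm := ⟨fun _ _ h => ⟨h.1.symm, h.2.imp fun _ he => he.symm⟩⟩
  loopless := ⟨fun _ h => h.1 rfl⟩

/-- The faces (cells) of the arrangement: the connected components of the complement of the
union of all pseudocircles. -/
def IsFace (F : Set X) : Prop :=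
  ∃ x ∈ A.supportᶜ, F = connectedComponentIn A.supportᶜ x

/-- `F` is a face whose boundary is the cycle of length `k` with the vertices
`v 0, …, v (k - 1)` and the edges `e j` from `v j` to `v (j + 1)` (cyclically). -/
structure IsFaceWithBoundary (F : Set X) {k : ℕ} [NeZero k] (v : Fin k → X)
    (e : Fin k → A.Edge) : Prop where
  isFace : A.IsFace F
  injective_vertex : Function.Injective v
  injective_edge : Function.Injective e
  joins : ∀ j, (e j).Joins (v j) (v (j + 1))
  frontier_eq : frontier F = ⋃ j, (e j).closedCarrier

/-- `F` is a `k`-gonal face: its boundary is a cycle of length `k`. -/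
def IsPolygonalFace (k : ℕ) [NeZero k] (F : Set X) : Prop :=
  ∃ (v : Fin k → X) (e : Fin k → A.Edge), A.IsFaceWithBoundary F v e

/-- An arrangement is triangle-saturated if every edge is incident to exactly one triangular
face. -/
def IsTriangleSaturated : Prop :=
  ∀ e : A.Edge, ∃! F : Set X, A.IsPolygonalFace 3 F ∧ e.openCarrier ⊆ frontier F

/-- `B` is a corona extension of `A` at the pentagonal face `P`: it is `A` together with one
additional pseudocircle, which runs once around `P`, crossing one after the other the ten edges
that leave the boundary of `P`, and no others.

The boundary of `P` has the vertices `p j` and the edges `e j` from `p j` to `p (j + 1)`.  On the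
other side of `e j` lies the triangular face `T j`, with third vertex `q j` and with the edges
`a j` from `p j` to `q j` and `b j` from `p (j + 1)` to `q j`.  The new pseudocircle
crosses `a j` at the parameter `x j` and `b j` at the parameter `y j`. -/
structure IsCoronaExtension (A : PseudocircleArrangement X ι)
    (B : PseudocircleArrangement X (Option ι)) (P : Set X) : Prop where
  curve_some : ∀ i, B.curve (some i) = A.curve i
  exists_corona : ∃ (p q : Fin 5 → X) (e a b : Fin 5 → A.Edge) (T : Fin 5 → Set X)
      (x y : Fin 5 → UnitAddCircle),
    A.IsFaceWithBoundary P p e ∧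
    (∀ j, A.IsFaceWithBoundary (T j) ![p j, p (j + 1), q j] ![e j, b j, a j]) ∧
    -- the new pseudocircle encloses `P`: the side that contains the closure of `P` contains
    -- no other vertices of `A` than those of `P`
    (∃ z ∈ (range (B.curve none))ᶜ,
      closure P ⊆ connectedComponentIn (range (B.curve none))ᶜ z ∧
      A.vertices ∩ connectedComponentIn (range (B.curve none))ᶜ z = range p) ∧
    -- it intersects only the pseudocircles that bound `P`
    (∀ i, (range (A.curve i) ∩ range (B.curve none)).Nonempty → ∃ j, (e j).idx = i) ∧
    -- it intersects them in the ten points with parameters `x j`, `y j` only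
    (∀ s, B.curve none s ∈ A.support → s ∈ range x ∪ range y) ∧
    (∀ j, B.curve none (x j) ∈ (a j).openCarrier) ∧
    (∀ j, B.curve none (y j) ∈ (b j).openCarrier) ∧
    -- it traverses `T j` from `x j` to `y j`, then a face that is not a triangle from `y j`
    -- to `x (j + 1)`
    (∀ j, B.curve none '' openArc (x j) (y j) ⊆ T j) ∧
    (∀ j, ∃ F, A.IsFace F ∧ ¬ A.IsPolygonalFace 3 F ∧
      B.curve none '' openArc (y j) (x (j + 1)) ⊆ F)

end PseudocircleArrangement

/-!
Every vertex of a simple arrangement has degree at most four, so by Brooks' theorem a colouring with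
four colours exists as soon as there is no clique with five vertices.  Such a clique would be closed
under adjacency.  In a triangle-saturated arrangement every vertex lies on exactly two triangles, so
a set of vertices that is closed under adjacency has a cardinality divisible by three, and five is
not.  In a corona extension, a clique that avoids the additional pseudocircle is a clique of the
original arrangement, and any other clique would contain all ten crossings.

Three colours do not suffice.  Let `N` be the number of triangles that the additional pseudocircle
avoids, and let `P i` and `Q i` be the numbers of `p j` and `q j` with the colour `i`.  Each of the
`N` triangles contains every colour exactly once, so counting the pairs of a triangle and one of its
vertices of colour `i` shows that `N + 2 * P i + Q i` is even.  In the extension, the crossings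
`x j`, `y j` span triangles with `q j`, and the crossings `y j`, `x (j + 1)` span triangles with
`p (j + 1)`; counting colours in both families gives `P i = Q i`.  Hence all the `P i` have the
parity of `N`.  This is impossible: they sum to five, and each is at most two since the `p j` form a
cycle.
-/

/-! ### Brooks' theorem -/

/-- `c` is a proper colouring of the subgraph of `G` induced on `S`.  The colouring is a total
function, so that it can be updated and glued without changing its type. -/
def IsProperOn {V C : Type*} (G : SimpleGraph V) (c : V → C) (S : Finset V) : Prop :=
  ∀ u ∈ S, ∀ w ∈ S, G.Adj u w → c u ≠ c w

/-- `U` arises from `{r}` by successively adding a vertex with a neighbour in the previous set.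
Removing the vertices in the opposite order leaves every vertex but `r` with a neighbour that is
still present, which is the order needed for greedy colouring towards `r`. -/
inductive GrowsFrom {V : Type*} [DecidableEq V] (G : SimpleGraph V) (r : V) : Finset V → Prop
  | singleton : GrowsFrom G r {r}
  | extend {u w : V} {U : Finset V} : GrowsFrom G r U → u ∉ U → w ∈ U → G.Adj u w →
      GrowsFrom G r (insert u U)

section Brooks

open scoped Finset

variable {V C : Type*} {G : SimpleGraph V} {k : ℕ}

theorem card_filter_adj_le [DecidableRel G.Adj] {v : V} (hv : (G.neighborSet v).encard ≤ k)
    (S : Finset V) : #{w ∈ S | G.Adj v w} ≤ k := by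
  have h : (↑({w ∈ S | G.Adj v w} : Finset V) : Set V) ⊆ G.neighborSet v :=
    fun _ hw => (Finset.mem_filter.1 hw).2
  simpa only [Set.encard_coe_eq_coe_finsetCard, Nat.cast_le] using
    (Set.encard_le_encard h).trans hv

theorem card_filter_adj_add_le [DecidableRel G.Adj] {v : V}
    (hv : (G.neighborSet v).encard ≤ k) {S T : Finset V} (hST : Disjoint S T) :
    #{w ∈ S | G.Adj v w} + #{w ∈ T | G.Adj v w} ≤ k := by
  classical
  rw [← Finset.card_union_of_disjoint (Finset.disjoint_filter_filter hST), ← Finset.filter_union]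
  exact card_filter_adj_le hv _

theorem mem_of_adj_of_isNClique {K : Finset V} (hK : G.IsNClique (k + 1) K) {u v : V}
    (hu : (G.neighborSet u).encard ≤ k) (huK : u ∈ K) (huv : G.Adj u v) : v ∈ K := by
  classical
  by_contra hv
  have hsub : insert v (K.erase u) ⊆ {w ∈ insert v K | G.Adj u w} := by
    intro w hw
    rcases Finset.mem_insert.1 hw with rfl | hw
    · simp [huv]
    · have hwK := Finset.mem_of_mem_erase hw
      simp [hwK, hK.isClique huK hwK (Finset.ne_of_mem_erase hw).symm]
  have hcard := (Finset.card_le_card hsub).trans (card_filter_adj_le hu _)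
  rw [Finset.card_insert_of_notMem fun h => hv (Finset.mem_of_mem_erase h),
    Finset.card_erase_of_mem huK, hK.card_eq] at hcard
  omega

namespace IsProperOn

theorem mono {c : V → C} {S T : Finset V} (h : IsProperOn G c T) (hST : S ⊆ T) :
    IsProperOn G c S :=
  fun u hu w hw => h u (hST hu) w (hST hw)

theorem update [DecidableEq V] {c : V → C} {S : Finset V} (h : IsProperOn G c S) {v : V}
    {x : C} (hx : ∀ w ∈ S, G.Adj v w → c w ≠ x) :
    IsProperOn G (Function.update c v x) (insert v S) := by
  intro u hu w hw huw
  rcases eq_or_ne u v with rfl | huv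
  · rw [Function.update_self, Function.update_of_ne huw.ne']
    exact (hx w (Finset.mem_of_mem_insert_of_ne hw huw.ne') huw).symm
  have huS := Finset.mem_of_mem_insert_of_ne hu huv
  rcases eq_or_ne w v with rfl | hwv
  · rw [Function.update_self, Function.update_of_ne huv]
    exact hx u huS huw.symm
  · rw [Function.update_of_ne huv, Function.update_of_ne hwv]
    exact h u huS w (Finset.mem_of_mem_insert_of_ne hw hwv) huw

theorem exists_insert_of_card_image_lt [DecidableEq V] [DecidableRel G.Adj] {c : V → Fin k}
    {S : Finset V} (h : IsProperOn G c S) {v : V} (hv : v ∉ S)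
    (hlt : #({w ∈ S | G.Adj v w}.image c) < k) :
    ∃ c' : V → Fin k, IsProperOn G c' (insert v S) ∧ ∀ u ∈ S, c' u = c u := by
  obtain ⟨x, -, hx⟩ := Finset.exists_mem_notMem_of_card_lt_card
    (hlt.trans_eq (Finset.card_fin k).symm)
  refine ⟨Function.update c v x, h.update ?_, fun u hu => ?_⟩
  · rintro w hw hvw rfl
    exact hx (Finset.mem_image_of_mem _ (Finset.mem_filter.2 ⟨hw, hvw⟩))
  · exact Function.update_of_ne (ne_of_mem_of_not_mem hu hv) _ _

end IsProperOn

theorem GrowsFrom.root_mem [DecidableEq V] {r : V} {U : Finset V} (h : GrowsFrom G r U) :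
    r ∈ U := by
  induction h with
  | singleton => exact Finset.mem_singleton_self r
  | extend _ _ _ _ ih => exact Finset.mem_insert_of_mem ih

theorem exists_growsFrom_forall_not_adj [DecidableEq V] {r : V} {S : Finset V} (hr : r ∈ S) :
    ∃ W ⊆ S, GrowsFrom G r W ∧ ∀ w ∈ W, ∀ u ∈ S \ W, ¬ G.Adj w u := by
  classical
  have hne : {W ∈ S.powerset | GrowsFrom G r W}.Nonempty :=
    ⟨{r}, by simp [hr, GrowsFrom.singleton]⟩
  obtain ⟨W, hW, hmax⟩ := Finset.exists_max_image _ Finset.card hne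
  rw [Finset.mem_filter, Finset.mem_powerset] at hW
  refine ⟨W, hW.1, hW.2, fun w hw u hu hwu => ?_⟩
  obtain ⟨huS, huW⟩ := Finset.mem_sdiff.1 hu
  have hle := hmax (insert u W) <| Finset.mem_filter.2
    ⟨Finset.mem_powerset.2 (Finset.insert_subset huS hW.1), hW.2.extend huW hw hwu.symm⟩
  rw [Finset.card_insert_of_notMem huW] at hle
  omega

/-- Two neighbours `a`, `b` of the root with the same colour leave a colour for the root. -/
theorem GrowsFrom.exists_isProperOn_union [DecidableEq V]
    (hdeg : ∀ v, (G.neighborSet v).encard ≤ k) {r a b : V} {U : Finset V}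
    (hU : GrowsFrom G r U) {S : Finset V} {c : V → Fin k} (hSU : Disjoint S U)
    (hc : IsProperOn G c S) (ha : a ∈ S) (hb : b ∈ S) (hab : a ≠ b) (hra : G.Adj r a)
    (hrb : G.Adj r b) (hcab : c a = c b) : ∃ c' : V → Fin k, IsProperOn G c' (S ∪ U) := by
  classical
  induction hU generalizing S c with
  | singleton =>
    have hrS : r ∉ S := Finset.disjoint_singleton_right.1 hSU
    obtain ⟨c', hc', -⟩ := hc.exists_insert_of_card_image_lt hrS <|
      calc #({w ∈ S | G.Adj r w}.image c)
        _ < #{w ∈ S | G.Adj r w} := by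
          refine Finset.card_image_le.lt_of_ne fun h => hab ?_
          exact Finset.card_image_iff.1 h (by simp [ha, hra]) (by simp [hb, hrb]) hcab
        _ ≤ k := card_filter_adj_le (hdeg r) S
    exact ⟨c', by rwa [Finset.union_comm, ← Finset.insert_eq]⟩
  | @extend u w U _ huU hwU huw ih =>
    rw [Finset.disjoint_insert_right] at hSU
    obtain ⟨c', hc', hcc'⟩ := hc.exists_insert_of_card_image_lt hSU.1 <| by
      have hle := card_filter_adj_add_le (hdeg u) hSU.2
      have hpos : 0 < #{w ∈ U | G.Adj u w} := Finset.card_pos.2 ⟨w, by simp [hwU, huw]⟩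
      have himage : #({w ∈ S | G.Adj u w}.image c) ≤ _ := Finset.card_image_le
      omega
    obtain ⟨d, hd⟩ := ih (Finset.disjoint_insert_left.2 ⟨huU, hSU.2⟩) hc'
      (Finset.mem_insert_of_mem ha) (Finset.mem_insert_of_mem hb)
      (by rw [hcc' a ha, hcc' b hb, hcab])
    exact ⟨d, by rwa [Finset.insert_union, ← Finset.union_insert] at hd⟩

theorem GrowsFrom.exists_isProperOn_insert_insert [DecidableEq V] (hk : 0 < k)
    (hdeg : ∀ v, (G.neighborSet v).encard ≤ k) {r a b : V} {U : Finset V}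
    (hU : GrowsFrom G r U) (ha : a ∉ U) (hb : b ∉ U) (hab : a ≠ b) (hnadj : ¬ G.Adj a b)
    (hra : G.Adj r a) (hrb : G.Adj r b) :
    ∃ c : V → Fin k, IsProperOn G c (insert a (insert b U)) := by
  have hcol : IsProperOn G (fun _ => (⟨0, hk⟩ : Fin k)) {a, b} := by
    simp [IsProperOn, hnadj, G.adj_comm b a]
  obtain ⟨c, hc⟩ := hU.exists_isProperOn_union hdeg (by simp [ha, hb]) hcol
    (Finset.mem_insert_self a _) (by simp) hab hra hrb rfl
  exact ⟨c, by rwa [Finset.insert_union, ← Finset.insert_eq] at hc⟩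

theorem exists_perm_apply_eq_and_apply_eq {x y x' y' : C} (h : x = y ↔ x' = y') :
    ∃ σ : Equiv.Perm C, σ x = x' ∧ σ y = y' := by
  by_cases hxy : x = y
  · obtain ⟨σ, hσ⟩ := MulAction.exists_smul_eq (Equiv.Perm C) x x'
    exact ⟨σ, hσ, hxy ▸ h.1 hxy ▸ hσ⟩
  · exact MulAction.is_two_pretransitive_iff.1 (Equiv.Perm.isMultiplyPretransitive C 2) hxy
      (h.not.1 hxy)

theorem exists_isProperOn_insert_insert_ne [DecidableEq V] [DecidableRel G.Adj] {a b : V}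
    {W : Finset V} {c : V → Fin k} (hc : IsProperOn G c (insert b W)) (hab : a ≠ b)
    (hnadj : ¬ G.Adj a b) (hdeg : #{w ∈ W | G.Adj a w} + 1 < k) :
    ∃ c : V → Fin k, IsProperOn G c (insert a (insert b W)) ∧ c a ≠ c b := by
  obtain ⟨x, -, hx⟩ := Finset.exists_mem_notMem_of_card_lt_card (t := Finset.univ)
    (s := insert (c b) ({w ∈ W | G.Adj a w}.image c)) <| by
      rw [Finset.card_fin]
      refine (Finset.card_insert_le _ _).trans_lt (lt_of_le_of_lt ?_ hdeg)
      gcongr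
      exact Finset.card_image_le
  rw [Finset.mem_insert, not_or] at hx
  refine ⟨Function.update c a x, hc.update ?_, ?_⟩
  · rintro w hw haw rfl
    rcases Finset.mem_insert.1 hw with rfl | hw
    · exact hnadj haw
    · exact hx.2 (Finset.mem_image_of_mem _ (Finset.mem_filter.2 ⟨hw, haw⟩))
  · rw [Function.update_self, Function.update_of_ne hab.symm]
    exact hx.1

theorem exists_isProperOn_insert_insert_eq [DecidableEq V] [DecidableRel G.Adj] {a b : V}
    {W : Finset V} {c : V → Fin k} (hc : IsProperOn G c W) (hb : b ∉ W) (hnadj : ¬ G.Adj a b)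
    (hdeg : #{w ∈ W | G.Adj a w} + #{w ∈ W | G.Adj b w} < k) :
    ∃ c : V → Fin k, IsProperOn G c (insert a (insert b W)) ∧ c a = c b := by
  obtain ⟨x, -, hx⟩ := Finset.exists_mem_notMem_of_card_lt_card (t := Finset.univ)
    (s := {w ∈ W | G.Adj a w}.image c ∪ {w ∈ W | G.Adj b w}.image c) <| by
      rw [Finset.card_fin]
      refine (Finset.card_union_le _ _).trans_lt (lt_of_le_of_lt ?_ hdeg)
      gcongr <;> exact Finset.card_image_le
  rw [Finset.mem_union, not_or] at hx
  have hcb : IsProperOn G (Function.update c b x) (insert b W) := hc.update <| by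
    rintro w hw hbw rfl
    exact hx.2 (Finset.mem_image_of_mem _ (Finset.mem_filter.2 ⟨hw, hbw⟩))
  refine ⟨Function.update (Function.update c b x) a x, hcb.update ?_, ?_⟩
  · rintro w hw haw hwx
    rcases Finset.mem_insert.1 hw with rfl | hw
    · exact hnadj haw
    · rw [Function.update_of_ne (ne_of_mem_of_not_mem hw hb)] at hwx
      exact hx.1 (hwx ▸ Finset.mem_image_of_mem _ (Finset.mem_filter.2 ⟨hw, haw⟩))
  · rw [Function.update_self]
    rcases eq_or_ne b a with rfl | hba
    · rw [Function.update_self]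
    · rw [Function.update_of_ne hba, Function.update_self]

theorem exists_isProperOn_ne_or_exists_isProperOn_eq [DecidableEq V] (hk : 3 ≤ k) {a b : V}
    (ha : (G.neighborSet a).encard ≤ k) (hb : (G.neighborSet b).encard ≤ k) (hab : a ≠ b)
    (hnadj : ¬ G.Adj a b) {Y Z : Finset V} (hbZ : b ∉ Z) (hYZ : Disjoint Y Z)
    (hY : ∃ c : V → Fin k, IsProperOn G c (insert a (insert b Y)))
    (hZ : ∃ c : V → Fin k, IsProperOn G c (insert a (insert b Z))) :
    (∃ c : V → Fin k, IsProperOn G c (insert a (insert b Y)) ∧ c a ≠ c b) ∨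
      ∃ c : V → Fin k, IsProperOn G c (insert a (insert b Z)) ∧ c a = c b := by
  classical
  obtain ⟨c, hc⟩ := hY
  obtain ⟨d, hd⟩ := hZ
  by_cases haY : #{w ∈ Y | G.Adj a w} + 1 < k
  · exact Or.inl <|
      exists_isProperOn_insert_insert_ne (hc.mono (Finset.subset_insert _ _)) hab hnadj haY
  by_cases hbY : #{w ∈ Y | G.Adj b w} + 1 < k
  · rw [Finset.insert_comm] at hc
    obtain ⟨c', hc', hne⟩ := exists_isProperOn_insert_insert_ne (hc.mono (Finset.subset_insert _ _))
      hab.symm (fun h => hnadj h.symm) hbY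
    exact Or.inl ⟨c', by rwa [Finset.insert_comm], hne.symm⟩
  have haYZ := card_filter_adj_add_le ha hYZ
  have hbYZ := card_filter_adj_add_le hb hYZ
  exact Or.inr <| exists_isProperOn_insert_insert_eq
    (hd.mono ((Finset.subset_insert _ _).trans (Finset.subset_insert _ _))) hbZ hnadj (by omega)

theorem IsProperOn.exists_glue [DecidableEq V] {W R : Finset V} {a b : V} {c d : V → C}
    (hc : IsProperOn G c (insert a (insert b W))) (hd : IsProperOn G d (insert a (insert b R)))
    (ha : a ∉ R) (hb : b ∉ R) (hWR : Disjoint W R)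
    (hnadj : ∀ w ∈ W, ∀ u ∈ R, ¬ G.Adj w u) (h : d a = d b ↔ c a = c b) :
    ∃ f : V → C, IsProperOn G f (insert a (insert b (W ∪ R))) := by
  obtain ⟨σ, hσa, hσb⟩ := exists_perm_apply_eq_and_apply_eq h
  let f : V → C := fun u => if u ∈ R then σ (d u) else c u
  have hfc : ∀ u ∈ insert a (insert b W), f u = c u := by
    intro u hu
    refine if_neg fun huR => ?_
    have := Finset.disjoint_right.1 hWR huR
    grind
  have hfd : ∀ u ∈ insert a (insert b R), f u = σ (d u) := by
    intro u hu
    grind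
  refine ⟨f, fun u hu w hw huw => ?_⟩
  by_cases hW : u ∈ insert a (insert b W) ∧ w ∈ insert a (insert b W)
  · rw [hfc u hW.1, hfc w hW.2]
    exact hc u hW.1 w hW.2 huw
  by_cases hR : u ∈ insert a (insert b R) ∧ w ∈ insert a (insert b R)
  · rw [hfd u hR.1, hfd w hR.2]
    exact σ.injective.ne (hd u hR.1 w hR.2 huw)
  have := hnadj u
  have := hnadj w
  have := huw.symm
  simp only [Finset.mem_insert, Finset.mem_union] at hu hw hW hR
  grind

theorem exists_isProperOn_insert_insert_union [DecidableEq V] (hk : 3 ≤ k) {a b : V}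
    (ha : (G.neighborSet a).encard ≤ k) (hb : (G.neighborSet b).encard ≤ k) (hab : a ≠ b)
    (hnadj : ¬ G.Adj a b) {W R : Finset V} (haR : a ∉ R) (hbW : b ∉ W) (hbR : b ∉ R)
    (hWR : Disjoint W R) (hsep : ∀ w ∈ W, ∀ u ∈ R, ¬ G.Adj w u)
    (hW : ∃ c : V → Fin k, IsProperOn G c (insert a (insert b W)))
    (hR : ∃ c : V → Fin k, IsProperOn G c (insert a (insert b R))) :
    ∃ c : V → Fin k, IsProperOn G c (insert a (insert b (W ∪ R))) := by
  have hneW := exists_isProperOn_ne_or_exists_isProperOn_eq hk ha hb hab hnadj hbR hWR hW hR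
  have hneR := exists_isProperOn_ne_or_exists_isProperOn_eq hk ha hb hab hnadj hbW hWR.symm hR hW
  obtain ⟨c, hc, d, hd, hcd⟩ : ∃ c : V → Fin k, IsProperOn G c (insert a (insert b W)) ∧
      ∃ d : V → Fin k, IsProperOn G d (insert a (insert b R)) ∧ (d a = d b ↔ c a = c b) := by
    obtain ⟨c, hc⟩ := hW
    obtain ⟨d, hd⟩ := hR
    by_cases c a = c b <;> by_cases d a = d b <;> grind
  exact hc.exists_glue hd haR hbR hWR hsep hcd

theorem exists_ne_and_not_adj_of_cliqueFree [DecidableRel G.Adj]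
    (hG : G.CliqueFree (k + 1)) {v : V} {S : Finset V} (hS : #{w ∈ S | G.Adj v w} = k) :
    ∃ a ∈ S, ∃ b ∈ S, G.Adj v a ∧ G.Adj v b ∧ a ≠ b ∧ ¬ G.Adj a b := by
  classical
  by_contra! hclique
  refine hG (insert v {w ∈ S | G.Adj v w}) ⟨?_, ?_⟩
  · rw [Finset.coe_insert, SimpleGraph.isClique_insert]
    simp only [Finset.coe_filter]
    exact ⟨fun a ha b hb => hclique a ha.1 b hb.1 ha.2 hb.2, fun b hb _ => hb.2⟩
  · rw [Finset.card_insert_of_notMem (by simp), hS]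

theorem exists_isProperOn_of_cliqueFree (hk : 3 ≤ k)
    (hdeg : ∀ v, (G.neighborSet v).encard ≤ k) (hG : G.CliqueFree (k + 1)) (S : Finset V) :
    ∃ c : V → Fin k, IsProperOn G c S := by
  classical
  induction S using Finset.strongInduction with
  | H S ih =>
  rcases S.eq_empty_or_nonempty with rfl | ⟨v, hv⟩
  · exact ⟨fun _ => ⟨0, by omega⟩, by simp [IsProperOn]⟩
  by_cases hlow : #{w ∈ S.erase v | G.Adj v w} < k
  · obtain ⟨c, hc⟩ := ih _ (Finset.erase_ssubset hv)
    obtain ⟨c', hc', -⟩ := hc.exists_insert_of_card_image_lt (Finset.notMem_erase v S)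
      (Finset.card_image_le.trans_lt hlow)
    exact ⟨c', by rwa [Finset.insert_erase hv] at hc'⟩
  obtain ⟨a, ha, b, hb, hva, hvb, hab, hnadj⟩ := exists_ne_and_not_adj_of_cliqueFree hG
    ((card_filter_adj_le (hdeg v) (S.erase v)).antisymm (not_lt.1 hlow))
  obtain ⟨S', haS', hbS', hS, hvS'⟩ :
      ∃ S', a ∉ S' ∧ b ∉ S' ∧ insert a (insert b S') = S ∧ v ∈ S' :=
    ⟨(S.erase a).erase b, by grind⟩
  obtain ⟨W, hWS, hW, hsep⟩ := exists_growsFrom_forall_not_adj (G := G) hvS'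
  by_cases hWeq : W = S'
  · rw [← hS, ← hWeq]
    exact hW.exists_isProperOn_insert_insert (by omega) hdeg (hWeq ▸ haS') (hWeq ▸ hbS') hab
      hnadj hva hvb
  have hproper : ∀ Y ⊂ S', ∃ c : V → Fin k, IsProperOn G c (insert a (insert b Y)) := by
    intro Y hY
    obtain ⟨x, hxS', hxY⟩ := Finset.exists_of_ssubset hY
    refine ih _ ((Finset.ssubset_iff_of_subset ?_).2 ⟨x, by grind⟩)
    rw [← hS]
    gcongr
  have hssub : S' \ W ⊂ S' := Finset.sdiff_ssubset hWS ⟨v, hW.root_mem⟩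
  obtain ⟨c, hc⟩ := exists_isProperOn_insert_insert_union hk (hdeg a) (hdeg b) hab hnadj
    (by grind) (by grind) (by grind) Finset.disjoint_sdiff hsep
    (hproper W (hWS.ssubset_of_ne hWeq)) (hproper (S' \ W) hssub)
  exact ⟨c, by rwa [Finset.union_sdiff_of_subset hWS, hS] at hc⟩

theorem colorable_of_cliqueFree_succ (hk : 3 ≤ k) (hdeg : ∀ v, (G.neighborSet v).encard ≤ k)
    (hG : G.CliqueFree (k + 1)) : G.Colorable k := by
  refine SimpleGraph.nonempty_hom_of_forall_finite_subgraph_hom fun G' hG' => ?_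
  choose c hc using exists_isProperOn_of_cliqueFree hk hdeg hG hG'.toFinset
  exact SimpleGraph.Coloring.mk (fun v => c v) fun {u v} huv =>
    hc u (by simp) v (by simp) (G'.adj_sub huv)

end Brooks

/-! ### Counting colours around a cycle -/

open Fin.NatCast in
theorem forall_fin_of_add_one {n : ℕ} [NeZero n] {p : Fin n → Prop} (h : ∀ j, p j → p (j + 1))
    {k : Fin n} (hk : p k) (j : Fin n) : p j := by
  have hadd (m : ℕ) : p (k + (m : Fin n)) := by
    induction m with
    | zero => simpa using hk
    | succ m ih => simpa [add_assoc] using h _ ih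
  simpa using hadd (j - k).val

section ColorCount

open scoped Finset

variable {α β : Type*} [Fintype α] [DecidableEq β]

/-- The number of elements that the colouring `c` gives the colour `i`. -/
def colorCount (c : α → β) (i : β) : ℕ := #{a | c a = i}

theorem colorCount_eq_sum (c : α → β) (i : β) :
    colorCount c i = ∑ a, if c a = i then 1 else 0 :=
  Finset.card_filter _ _

theorem colorCount_comp_equiv (c : α → β) (σ : α ≃ α) (i : β) :
    colorCount (fun a => c (σ a)) i = colorCount c i := by
  simp only [colorCount_eq_sum]
  exact σ.sum_comp fun a => if c a = i then 1 else 0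

theorem sum_colorCount [Fintype β] (c : α → β) : ∑ i, colorCount c i = Fintype.card α :=
  (Finset.card_eq_sum_card_fiberwise fun a _ => Finset.mem_univ (c a)).symm

theorem colorCount_comp_add_one {n : ℕ} [NeZero n] (c : Fin n → β) (i : β) :
    colorCount (fun j => c (j + 1)) i = colorCount c i :=
  colorCount_comp_equiv c (Equiv.addRight 1) i

theorem colorCount_add_colorCount_le {c d : α → β} (hcd : ∀ a, c a ≠ d a) (i : β) :
    colorCount c i + colorCount d i ≤ Fintype.card α := by
  classical
  have hdisj : Disjoint ({a | c a = i} : Finset α) ({a | d a = i} : Finset α) :=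
    Finset.disjoint_filter.2 fun a _ hc hd => hcd a (hc.trans hd.symm)
  rw [colorCount, colorCount, ← Finset.card_union_of_disjoint hdisj]
  exact Finset.card_le_univ _

theorem two_mul_colorCount_le {n : ℕ} [NeZero n] {c : Fin n → β} (hc : ∀ j, c j ≠ c (j + 1))
    (i : β) : 2 * colorCount c i ≤ n := by
  have hle := colorCount_add_colorCount_le hc i
  rwa [colorCount_comp_add_one, ← two_mul, Fintype.card_fin] at hle

theorem ite_add_ite_add_ite_eq_one {u v w : Fin 3} (huv : u ≠ v) (hvw : v ≠ w) (hwu : w ≠ u)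
    (i : Fin 3) :
    (if u = i then 1 else 0) + (if v = i then 1 else 0) + (if w = i then 1 else 0) = 1 := by
  revert u v w i
  decide

theorem colorCount_add_colorCount_add_colorCount {c d e : α → Fin 3} (hcd : ∀ a, c a ≠ d a)
    (hde : ∀ a, d a ≠ e a) (hec : ∀ a, e a ≠ c a) (i : Fin 3) :
    colorCount c i + colorCount d i + colorCount e i = Fintype.card α := by
  simp only [colorCount_eq_sum, ← Finset.sum_add_distrib,
    ite_add_ite_add_ite_eq_one (hcd _) (hde _) (hec _) i, Finset.sum_const, Finset.card_univ,
    smul_eq_mul, mul_one]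

theorem colorCount_eq_of_cap_of_ring {n : ℕ} [NeZero n] {p q x y : Fin n → Fin 3}
    (hpx : ∀ j, p j ≠ x j) (hpy : ∀ j, p (j + 1) ≠ y j) (hqx : ∀ j, q j ≠ x j)
    (hqy : ∀ j, q j ≠ y j) (hxy : ∀ j, x j ≠ y j) (hyx : ∀ j, y j ≠ x (j + 1)) (i : Fin 3) :
    colorCount p i = colorCount q i := by
  have hcap := colorCount_add_colorCount_add_colorCount hqx hxy (fun j => (hqy j).symm) i
  have hring := colorCount_add_colorCount_add_colorCount hpy hyx (fun j => (hpx (j + 1)).symm) i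
  rw [colorCount_comp_add_one, colorCount_comp_add_one] at hring
  lia

theorem not_forall_even_add_colorCount {c : Fin 5 → Fin 3} (hc : ∀ j, c j ≠ c (j + 1)) (N : ℕ) :
    ¬ ∀ i, Even (N + colorCount c i) := by
  intro heven
  have hsum := sum_colorCount c
  rw [Fin.sum_univ_three, Fintype.card_fin] at hsum
  have hle := two_mul_colorCount_le hc
  have h₀ := Nat.even_iff.1 (heven 0)
  have h₁ := Nat.even_iff.1 (heven 1)
  have h₂ := Nat.even_iff.1 (heven 2)
  have := hle 0
  have := hle 1
  have := hle 2
  lia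

end ColorCount

/-! ### Arcs, edges and boundaries of faces -/

section Arc

variable {s t s' t' m x : UnitAddCircle}

theorem sbtw_of_mem_openArc (hst : s ≠ t) (hx : x ∈ openArc s t) : sbtw s x t := by
  refine sbtw_of_btw_not_btw hx.1 fun h => ?_
  rcases hx.1.antisymm h with h | h | h
  · exact hx.2.1 h.symm
  · exact hx.2.2 h
  · exact hst h.symm

theorem mem_openArc_of_sbtw (h : sbtw s x t) : x ∈ openArc s t := by
  refine ⟨h.btw, ?_, ?_⟩
  · rintro rfl
    exact sbtw_irrefl_left h
  · rintro rfl
    exact sbtw_irrefl_right h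

theorem mem_openArc_self (h : x ≠ s) : x ∈ openArc s s :=
  ⟨btw_rfl_left_right, h, h⟩

theorem left_notMem_openArc (s t : UnitAddCircle) : s ∉ openArc s t := fun h => h.2.1 rfl

theorem right_notMem_openArc (s t : UnitAddCircle) : t ∉ openArc s t := fun h => h.2.2 rfl

theorem left_mem_closedArc (s t : UnitAddCircle) : s ∈ closedArc s t := btw_refl_left s t

theorem right_mem_closedArc (s t : UnitAddCircle) : t ∈ closedArc s t := btw_refl_right s t

theorem openArc_subset_closedArc (s t : UnitAddCircle) : openArc s t ⊆ closedArc s t :=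
  fun _ h => h.1

theorem openArc_subset_left (hm : m ∈ openArc s t) : openArc s m ⊆ openArc s t := by
  intro x hx
  have hsxm := sbtw_of_mem_openArc hm.2.1.symm hx
  rcases eq_or_ne s t with rfl | hst
  · exact mem_openArc_self hx.2.1
  · exact mem_openArc_of_sbtw (sbtw_trans_right hsxm (sbtw_of_mem_openArc hst hm))

theorem openArc_subset_right (hm : m ∈ openArc s t) : openArc m t ⊆ openArc s t := by
  intro x hx
  have hmxt := sbtw_of_mem_openArc hm.2.2 hx
  rcases eq_or_ne s t with rfl | hst
  · exact mem_openArc_self hx.2.2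
  · exact mem_openArc_of_sbtw ((sbtw_of_mem_openArc hst hm).trans_left hmxt)

theorem openArc_left_unique (hx : x ∈ openArc s t) (hx' : x ∈ openArc s' t')
    (hs : s ∉ openArc s' t') (hs' : s' ∉ openArc s t) : s = s' := by
  by_contra hne
  have hxs : x ≠ s := hx.2.1
  have hxs' : x ≠ s' := hx'.2.1
  rcases btw_total s s' x with h | h
  · exact hs' (openArc_subset_left hx ⟨h, Ne.symm hne, hxs'.symm⟩)
  · exact hs (openArc_subset_left hx' ⟨h.cyclic_left, hne, hxs.symm⟩)

theorem openArc_right_eq (ht : t ∉ openArc s t') (ht' : t' ∉ openArc s t) : t = t' := by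
  by_contra hne
  rcases eq_or_ne t s with rfl | hts
  · exact ht' (mem_openArc_self (Ne.symm hne))
  rcases eq_or_ne t' s with rfl | hts'
  · exact ht (mem_openArc_self hne)
  rcases btw_total s t t' with h | h
  · exact ht ⟨h, hts, hne⟩
  · exact ht' ⟨btw_cyclic_right h, hts', Ne.symm hne⟩

theorem openArc_left_eq (hs : s ∉ openArc s' t) (hs' : s' ∉ openArc s t) : s = s' := by
  by_contra hne
  rcases eq_or_ne s t with rfl | hst
  · exact hs' (mem_openArc_self (Ne.symm hne))
  rcases eq_or_ne s' t with rfl | hst'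
  · exact hs (mem_openArc_self hne)
  rcases btw_total s s' t with h | h
  · exact hs' ⟨h, Ne.symm hne, hst'⟩
  · exact hs ⟨h.cyclic_left, hne, hst⟩

theorem coe_mem_openArc {a b m : ℝ} (ham : a < m) (hmb : m < b) (hba : b ≤ a + 1) :
    (m : UnitAddCircle) ∈ openArc (a : UnitAddCircle) b := by
  refine ⟨?_, fun h => ham.ne' ?_, fun h => hmb.ne ?_⟩
  · refine QuotientAddGroup.btw_coe_iff.2 ?_
    rw [(toIcoMod_eq_self _).2 ⟨ham.le, by linarith⟩,
      (toIocMod_eq_self _).2 ⟨ham.trans hmb, hba⟩]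
    exact hmb.le
  · exact (AddCircle.coe_eq_coe_iff_of_mem_Ico (a := a) ⟨ham.le, by linarith⟩
      ⟨le_rfl, by linarith⟩).1 h
  · exact (AddCircle.coe_eq_coe_iff_of_mem_Ico (a := m) ⟨le_rfl, by linarith⟩
      ⟨hmb.le, by linarith⟩).1 h

theorem openArc_nonempty (s t : UnitAddCircle) : (openArc s t).Nonempty := by
  obtain ⟨a, rfl⟩ := QuotientAddGroup.mk_surjective s
  obtain ⟨b, hb, rfl⟩ : ∃ b ∈ Ioc a (a + 1), (b : UnitAddCircle) = t :=
    ⟨AddCircle.equivIoc 1 a t, (AddCircle.equivIoc 1 a t).2,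
      (AddCircle.equivIoc 1 a).symm_apply_apply t⟩
  obtain ⟨m, ham, hmb⟩ := exists_between hb.1
  exact ⟨m, coe_mem_openArc ham hmb hb.2⟩

theorem exists_forall_mem_openArc_notMem {S : Set UnitAddCircle} (hS : S.Finite)
    (hne : S.Nonempty) (s : UnitAddCircle) : ∃ t ∈ S, ∀ x ∈ openArc s t, x ∉ S := by
  obtain ⟨t, ht, hmin⟩ := hS.exists_minimalFor (openArc s) S hne
  exact ⟨t, ht, fun m hm hmS =>
    right_notMem_openArc s m (hmin hmS (openArc_subset_left hm) hm)⟩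

theorem exists_forall_mem_openArc_notMem' {S : Set UnitAddCircle} (hS : S.Finite)
    (hne : S.Nonempty) (t : UnitAddCircle) : ∃ s ∈ S, ∀ x ∈ openArc s t, x ∉ S := by
  obtain ⟨s, hs, hmin⟩ := hS.exists_minimalFor (openArc · t) S hne
  exact ⟨s, hs, fun m hm hmS =>
    left_notMem_openArc m t (hmin hmS (openArc_subset_right hm) hm)⟩

end Arc

namespace PseudocircleArrangement

variable {X : Type*} [TopologicalSpace X] {ι : Type*} {A : PseudocircleArrangement X ι}

theorem finite_vertices [Finite ι] (A : PseudocircleArrangement X ι) : A.vertices.Finite := by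
  have hsub : A.vertices ⊆ ⋃ p : {p : ι × ι // p.1 ≠ p.2},
      range (A.curve p.1.1) ∩ range (A.curve p.1.2) := by
    rintro x ⟨i, j, hij, hx⟩
    exact mem_iUnion.2 ⟨⟨(i, j), hij⟩, hx⟩
  exact (finite_iUnion fun p =>
    finite_of_encard_le_coe (k := 2) (A.inter_le_two _ _ p.2)).subset hsub

theorem IsSimple.encard_setOf_mem_range_curve (hs : A.IsSimple) (v : A.vertices) :
    {i | ↑v ∈ range (A.curve i)}.encard = 2 := by
  obtain ⟨i, j, hij, hi, hj⟩ := v.2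
  refine encard_eq_two.2 ⟨i, j, hij, Subset.antisymm (fun k hk => ?_) ?_⟩
  · by_contra! hne
    simp only [mem_insert_iff, mem_singleton_iff, not_or] at hne
    exact (hs i j k hij (Ne.symm hne.2) (Ne.symm hne.1)).le ⟨⟨hi, hj⟩, hk⟩
  · rintro k (rfl | rfl)
    exacts [hi, hj]

/-- The vertex at which an edge starts, in the direction of the parametrization. -/
def Edge.source (e : A.Edge) : A.vertices := ⟨A.curve e.idx e.src, e.src_mem⟩

/-- The vertex at which an edge ends, in the direction of the parametrization. -/
def Edge.target (e : A.Edge) : A.vertices := ⟨A.curve e.idx e.tgt, e.tgt_mem⟩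

theorem Edge.src_notMem_openArc {e f : A.Edge} (h : e.idx = f.idx) :
    e.src ∉ openArc f.src f.tgt :=
  fun hm => f.interior_notMem _ hm (h ▸ e.src_mem)

theorem Edge.tgt_notMem_openArc {e f : A.Edge} (h : e.idx = f.idx) :
    e.tgt ∉ openArc f.src f.tgt :=
  fun hm => f.interior_notMem _ hm (h ▸ e.tgt_mem)

theorem Edge.eq_of_idx_eq_of_source_eq {e f : A.Edge} (hidx : e.idx = f.idx)
    (hv : e.source = f.source) : e = f := by
  have hcurve : A.curve e.idx e.src = A.curve f.idx f.src := congrArg Subtype.val hv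
  have hsrc : e.src = f.src := A.injective_curve f.idx (hidx ▸ hcurve)
  refine Edge.ext hidx hsrc (openArc_right_eq (s := e.src) ?_ (tgt_notMem_openArc hidx.symm))
  exact hsrc ▸ tgt_notMem_openArc hidx

theorem Edge.eq_of_idx_eq_of_target_eq {e f : A.Edge} (hidx : e.idx = f.idx)
    (hv : e.target = f.target) : e = f := by
  have hcurve : A.curve e.idx e.tgt = A.curve f.idx f.tgt := congrArg Subtype.val hv
  have htgt : e.tgt = f.tgt := A.injective_curve f.idx (hidx ▸ hcurve)
  refine Edge.ext hidx (openArc_left_eq (t := e.tgt) ?_ (src_notMem_openArc hidx.symm)) htgt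
  exact htgt ▸ src_notMem_openArc hidx

theorem Edge.injOn_idx_source (v : A.vertices) :
    InjOn Edge.idx {e : A.Edge | e.source = v} :=
  fun _ he _ hf hidx => eq_of_idx_eq_of_source_eq hidx (he.trans hf.symm)

theorem Edge.injOn_idx_target (v : A.vertices) :
    InjOn Edge.idx {e : A.Edge | e.target = v} :=
  fun _ he _ hf hidx => eq_of_idx_eq_of_target_eq hidx (he.trans hf.symm)

theorem Edge.image_idx_source_subset (v : A.vertices) :
    Edge.idx '' {e : A.Edge | e.source = v} ⊆ {i | ↑v ∈ range (A.curve i)} := by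
  rintro _ ⟨e, rfl, rfl⟩
  exact ⟨e.src, rfl⟩

theorem Edge.image_idx_target_subset (v : A.vertices) :
    Edge.idx '' {e : A.Edge | e.target = v} ⊆ {i | ↑v ∈ range (A.curve i)} := by
  rintro _ ⟨e, rfl, rfl⟩
  exact ⟨e.tgt, rfl⟩

theorem Edge.image_idx_source [Finite ι] (v : A.vertices) :
    Edge.idx '' {e : A.Edge | e.source = v} = {i | ↑v ∈ range (A.curve i)} := by
  refine (image_idx_source_subset v).antisymm fun i ⟨s, hs⟩ => ?_
  have hsv : A.curve i s ∈ A.vertices := hs ▸ v.2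
  obtain ⟨t, ht, hst⟩ := exists_forall_mem_openArc_notMem
    (A.finite_vertices.preimage (A.injective_curve i).injOn) ⟨s, hsv⟩ s
  exact ⟨⟨i, s, t, hsv, ht, hst⟩, Subtype.ext hs, rfl⟩

theorem Edge.image_idx_target [Finite ι] (v : A.vertices) :
    Edge.idx '' {e : A.Edge | e.target = v} = {i | ↑v ∈ range (A.curve i)} := by
  refine (image_idx_target_subset v).antisymm fun i ⟨t, ht⟩ => ?_
  have htv : A.curve i t ∈ A.vertices := ht ▸ v.2
  obtain ⟨s, hs, hst⟩ := exists_forall_mem_openArc_notMem'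
    (A.finite_vertices.preimage (A.injective_curve i).injOn) ⟨t, htv⟩ t
  exact ⟨⟨i, s, t, hs, htv, hst⟩, Subtype.ext ht, rfl⟩

theorem IsSimple.encard_source_le (hs : A.IsSimple) (v : A.vertices) :
    {e : A.Edge | e.source = v}.encard ≤ 2 := by
  rw [← (Edge.injOn_idx_source v).encard_image, ← hs.encard_setOf_mem_range_curve v]
  exact encard_le_encard (Edge.image_idx_source_subset v)

theorem IsSimple.encard_target_le (hs : A.IsSimple) (v : A.vertices) :
    {e : A.Edge | e.target = v}.encard ≤ 2 := by
  rw [← (Edge.injOn_idx_target v).encard_image, ← hs.encard_setOf_mem_range_curve v]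
  exact encard_le_encard (Edge.image_idx_target_subset v)

theorem IsSimple.encard_source [Finite ι] (hs : A.IsSimple) (v : A.vertices) :
    {e : A.Edge | e.source = v}.encard = 2 := by
  rw [← (Edge.injOn_idx_source v).encard_image, Edge.image_idx_source,
    hs.encard_setOf_mem_range_curve]

theorem IsSimple.encard_target [Finite ι] (hs : A.IsSimple) (v : A.vertices) :
    {e : A.Edge | e.target = v}.encard = 2 := by
  rw [← (Edge.injOn_idx_target v).encard_image, Edge.image_idx_target,
    hs.encard_setOf_mem_range_curve]

instance [Finite ι] : Finite A.Edge := by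
  have := A.finite_vertices.to_subtype
  refine Finite.of_injective (fun e : A.Edge => (e.idx, e.source)) fun e f h => ?_
  exact Edge.eq_of_idx_eq_of_source_eq (congrArg Prod.fst h) (congrArg Prod.snd h)

theorem Edge.Joins.symm {e : A.Edge} {u v : X} (h : e.Joins u v) : e.Joins v u := Or.symm h

theorem Edge.Joins.left_mem {e : A.Edge} {u v : X} (h : e.Joins u v) : u ∈ A.vertices := by
  rcases h with ⟨rfl, -⟩ | ⟨-, rfl⟩
  exacts [e.src_mem, e.tgt_mem]

theorem IsSimple.encard_neighborSet_le (hs : A.IsSimple) (v : A.vertices) :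
    (A.graph.neighborSet v).encard ≤ 4 := by
  have hsub : A.graph.neighborSet v ⊆
      Edge.target '' {e : A.Edge | e.source = v} ∪ Edge.source '' {e : A.Edge | e.target = v} := by
    rintro w ⟨-, e, ⟨hv, hw⟩ | ⟨hw, hv⟩⟩
    exacts [Or.inl ⟨e, Subtype.ext hv, Subtype.ext hw⟩, Or.inr ⟨e, Subtype.ext hv, Subtype.ext hw⟩]
  calc (A.graph.neighborSet v).encard
      ≤ _ := (encard_le_encard hsub).trans (encard_union_le _ _)
    _ ≤ 2 + 2 := add_le_add ((encard_image_le _ _).trans (hs.encard_source_le v))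
        ((encard_image_le _ _).trans (hs.encard_target_le v))
    _ = 4 := by norm_num

theorem Edge.nonempty_openCarrier (e : A.Edge) : e.openCarrier.Nonempty :=
  (openArc_nonempty _ _).image _

theorem Edge.notMem_vertices_of_mem_openCarrier {e : A.Edge} {z : X} (h : z ∈ e.openCarrier) :
    z ∉ A.vertices := by
  obtain ⟨x, hx, rfl⟩ := h
  exact e.interior_notMem x hx

theorem Edge.openCarrier_subset_closedCarrier (e : A.Edge) : e.openCarrier ⊆ e.closedCarrier :=
  image_mono (openArc_subset_closedArc _ _)

theorem Edge.Joins.vertices_inter_closedCarrier {e : A.Edge} {u v : X} (h : e.Joins u v) :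
    A.vertices ∩ e.closedCarrier = {u, v} := by
  have hsrc : A.curve e.idx e.src ∈ A.vertices ∩ e.closedCarrier :=
    ⟨e.src_mem, mem_image_of_mem _ (left_mem_closedArc _ _)⟩
  have htgt : A.curve e.idx e.tgt ∈ A.vertices ∩ e.closedCarrier :=
    ⟨e.tgt_mem, mem_image_of_mem _ (right_mem_closedArc _ _)⟩
  have hsub : A.vertices ∩ e.closedCarrier ⊆ {A.curve e.idx e.src, A.curve e.idx e.tgt} := by
    rintro _ ⟨hv, x, hx, rfl⟩
    by_contra! hne
    simp only [mem_insert_iff, mem_singleton_iff, not_or] at hne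
    exact e.interior_notMem x
      ⟨hx, ne_of_apply_ne _ hne.1, ne_of_apply_ne _ hne.2⟩ hv
  have heq := hsub.antisymm (insert_subset hsrc (singleton_subset_iff.2 htgt))
  rcases h with ⟨rfl, rfl⟩ | ⟨rfl, rfl⟩
  exacts [heq, heq.trans (pair_comm _ _)]

theorem Edge.eq_of_mem_openCarrier_of_mem_closedCarrier {e f : A.Edge} {z : X}
    (he : z ∈ e.openCarrier) (hf : z ∈ f.closedCarrier) : e = f := by
  obtain ⟨x, hx, rfl⟩ := he
  obtain ⟨y, hy, hyx⟩ := hf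
  have hidx : e.idx = f.idx := by
    by_contra hne
    exact e.interior_notMem x hx ⟨e.idx, f.idx, hne, ⟨x, rfl⟩, ⟨y, hyx⟩⟩
  obtain rfl : y = x := A.injective_curve f.idx (hidx ▸ hyx)
  have hyf : A.curve f.idx y ∉ A.vertices := hidx ▸ e.interior_notMem y hx
  have hy' : y ∈ openArc f.src f.tgt :=
    ⟨hy, fun h => hyf (h ▸ f.src_mem), fun h => hyf (h ▸ f.tgt_mem)⟩
  refine eq_of_idx_eq_of_source_eq hidx (Subtype.ext ?_)
  have hsrc : e.src = f.src :=
    openArc_left_unique hx hy' (src_notMem_openArc hidx) (src_notMem_openArc hidx.symm)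
  exact congrArg₂ A.curve hidx hsrc

theorem IsFaceWithBoundary.openCarrier_subset_iff {F : Set X} {k : ℕ} [NeZero k] {v : Fin k → X}
    {e : Fin k → A.Edge} (h : A.IsFaceWithBoundary F v e) {f : A.Edge} :
    f.openCarrier ⊆ frontier F ↔ f ∈ range e := by
  rw [h.frontier_eq]
  constructor
  · intro hf
    obtain ⟨z, hz⟩ := f.nonempty_openCarrier
    obtain ⟨j, hj⟩ := mem_iUnion.1 (hf hz)
    exact ⟨j, (Edge.eq_of_mem_openCarrier_of_mem_closedCarrier hz hj).symm⟩
  · rintro ⟨j, rfl⟩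
    exact (e j).openCarrier_subset_closedCarrier.trans
      (subset_iUnion (fun j => (e j).closedCarrier) j)

theorem IsFaceWithBoundary.vertices_inter_frontier {F : Set X} {k : ℕ} [NeZero k]
    {v : Fin k → X} {e : Fin k → A.Edge} (h : A.IsFaceWithBoundary F v e) :
    A.vertices ∩ frontier F = range v := by
  simp only [h.frontier_eq, inter_iUnion, (h.joins _).vertices_inter_closedCarrier]
  refine Subset.antisymm (iUnion_subset fun j => ?_) ?_
  · exact insert_subset (mem_range_self _) (singleton_subset_iff.2 (mem_range_self _))
  · rintro _ ⟨j, rfl⟩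
    exact mem_iUnion.2 ⟨j, mem_insert _ _⟩

theorem IsFaceWithBoundary.mem_frontier_iff {F : Set X} {k : ℕ} [NeZero k] {v : Fin k → X}
    {e : Fin k → A.Edge} (h : A.IsFaceWithBoundary F v e) (w : A.vertices) :
    ↑w ∈ frontier F ↔ ↑w ∈ range v := by
  rw [← h.vertices_inter_frontier, mem_inter_iff, and_iff_right w.2]

/-! ### Triangle-saturated arrangements -/

section Saturation

open scoped Finset

open Classical in
/-- The number of ends of the edge `e` that are equal to the vertex `v`; a loop at `v` has two. -/
noncomputable def Edge.endCount (e : A.Edge) (v : A.vertices) : ℕ :=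
  (if e.source = v then 1 else 0) + if e.target = v then 1 else 0

open Classical in
theorem Edge.Joins.endCount_eq {e : A.Edge} {u w : X} (h : e.Joins u w) (v : A.vertices) :
    e.endCount v = (if u = v then 1 else 0) + if w = v then 1 else 0 := by
  rcases h with ⟨rfl, rfl⟩ | ⟨rfl, rfl⟩
  · simp only [Edge.endCount, Subtype.ext_iff, Edge.source, Edge.target]
  · simp only [Edge.endCount, Subtype.ext_iff, Edge.source, Edge.target, add_comm]

theorem IsSimple.sum_endCount [Finite ι] [Fintype A.Edge] (hs : A.IsSimple) (v : A.vertices) :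
    ∑ e : A.Edge, e.endCount v = 4 := by
  classical
  have hsource : #{e : A.Edge | e.source = v} = 2 := by
    rw [← ENat.natCast_inj, ← encard_coe_eq_coe_finsetCard, Finset.coe_filter_univ]
    exact hs.encard_source v
  have htarget : #{e : A.Edge | e.target = v} = 2 := by
    rw [← ENat.natCast_inj, ← encard_coe_eq_coe_finsetCard, Finset.coe_filter_univ]
    exact hs.encard_target v
  simp only [Edge.endCount, Finset.sum_add_distrib, Finset.sum_boole, Nat.cast_id, hsource, htarget]

open Classical in
theorem IsFaceWithBoundary.sum_endCount {F : Set X} {k : ℕ} [NeZero k] {v : Fin k → X}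
    {e : Fin k → A.Edge} (h : A.IsFaceWithBoundary F v e) (w : A.vertices) :
    ∑ j, (e j).endCount w = if ↑w ∈ frontier F then 2 else 0 := by
  have hshift : ∑ j, (if v (j + 1) = w then 1 else 0) = ∑ j, if v j = w then 1 else 0 :=
    Equiv.sum_comp (Equiv.addRight (1 : Fin k)) fun j => if v j = w then 1 else 0
  simp only [fun j => (h.joins j).endCount_eq w, Finset.sum_add_distrib, hshift,
    h.mem_frontier_iff]
  split_ifs with hw
  · obtain ⟨i, hi⟩ := hw
    simp only [← hi, h.injective_vertex.eq_iff, Finset.sum_ite_eq', Finset.mem_univ, if_true]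
  · have hne : ∀ j, v j ≠ w := fun j hj => hw ⟨j, hj⟩
    simp only [hne, if_false, Finset.sum_const_zero, add_zero]

open Classical in
theorem IsFaceWithBoundary.card_filter_mem_frontier {F : Set X} {k : ℕ} [NeZero k]
    {v : Fin k → A.vertices} {e : Fin k → A.Edge}
    (h : A.IsFaceWithBoundary F (fun j => ↑(v j)) e) (S : Finset A.vertices) :
    #{w ∈ S | ↑w ∈ frontier F} = #{j | v j ∈ S} := by
  have himage : {w ∈ S | ↑w ∈ frontier F} = Finset.image v {j | v j ∈ S} := by
    ext w
    simp only [Finset.mem_filter, h.mem_frontier_iff, mem_range, Subtype.val_inj,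
      Finset.mem_image, Finset.mem_univ, true_and]
    constructor
    · rintro ⟨hw, j, rfl⟩
      exact ⟨j, hw, rfl⟩
    · rintro ⟨j, hj, rfl⟩
      exact ⟨hj, j, rfl⟩
  rw [himage, Finset.card_image_of_injective _ (Function.Injective.of_comp h.injective_vertex)]

/-- The triangular faces of an arrangement. -/
def triangles (A : PseudocircleArrangement X ι) : Set (Set X) := {F | A.IsPolygonalFace 3 F}

theorem IsTriangleSaturated.exists_triangle (hsat : A.IsTriangleSaturated) :
    ∃ τ : A.Edge → A.triangles, ∀ (e : A.Edge) (F : A.triangles),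
      e.openCarrier ⊆ frontier F.1 ↔ τ e = F := by
  choose τ hτ huniq using hsat
  refine ⟨fun e => ⟨τ e, (hτ e).1⟩, fun e F => ⟨fun h => ?_, ?_⟩⟩
  · exact Subtype.ext (huniq e F ⟨F.2, h⟩).symm
  · rintro rfl
    exact (hτ e).2

theorem IsTriangleSaturated.finite_triangles [Finite ι] (hsat : A.IsTriangleSaturated) :
    A.triangles.Finite := by
  obtain ⟨τ, hτ⟩ := hsat.exists_triangle
  have hsurj : Function.Surjective τ := fun F => by
    obtain ⟨v, e, h⟩ := F.2
    exact ⟨e 0, (hτ _ _).1 (h.openCarrier_subset_iff.2 ⟨0, rfl⟩)⟩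
  exact finite_coe_iff.1 (Finite.of_surjective τ hsurj)

open Classical in
theorem IsTriangleSaturated.card_triangles_through [Finite ι] [Fintype A.triangles]
    (hsat : A.IsTriangleSaturated) (hs : A.IsSimple) (v : A.vertices) :
    #{F : A.triangles | ↑v ∈ frontier F.1} = 2 := by
  have := Fintype.ofFinite A.Edge
  obtain ⟨τ, hτ⟩ := hsat.exists_triangle
  have hboundary (F : A.triangles) :
      ∑ e with τ e = F, e.endCount v = if ↑v ∈ frontier F.1 then 2 else 0 := by
    obtain ⟨w, f, h⟩ := F.2
    have himage : ({e | τ e = F} : Finset A.Edge) = Finset.image f Finset.univ := by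
      ext e
      simp only [← hτ, h.openCarrier_subset_iff, Finset.mem_filter, Finset.mem_univ, true_and,
        Finset.mem_image, mem_range]
    rw [himage, Finset.sum_image h.injective_edge.injOn, h.sum_endCount]
  have hsum : ∑ F : A.triangles, (if ↑v ∈ frontier F.1 then 2 else 0) = 4 := by
    rw [← hs.sum_endCount v, ← Finset.sum_fiberwise Finset.univ τ]
    exact Finset.sum_congr rfl fun F _ => (hboundary F).symm
  rw [← Finset.sum_filter, Finset.sum_const, smul_eq_mul] at hsum
  lia

open Classical in
theorem IsTriangleSaturated.sum_card_filter_mem_frontier [Finite ι] [Fintype A.triangles]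
    (hsat : A.IsTriangleSaturated) (hs : A.IsSimple) (S : Finset A.vertices) :
    ∑ F : A.triangles, #{v ∈ S | ↑v ∈ frontier F.1} = 2 * #S := by
  calc ∑ F : A.triangles, #{v ∈ S | ↑v ∈ frontier F.1}
      = ∑ v ∈ S, #{F : A.triangles | ↑v ∈ frontier F.1} :=
        Finset.sum_card_bipartiteAbove_eq_sum_card_bipartiteBelow
          fun (F : A.triangles) (v : A.vertices) => ↑v ∈ frontier F.1
    _ = ∑ _v ∈ S, 2 := Finset.sum_congr rfl fun v _ => hsat.card_triangles_through hs v
    _ = 2 * #S := by rw [Finset.sum_const, smul_eq_mul, mul_comm]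

theorem IsFaceWithBoundary.exists_vertex_lift {F : Set X} {k : ℕ} [NeZero k] {v : Fin k → X}
    {e : Fin k → A.Edge} (h : A.IsFaceWithBoundary F v e) :
    ∃ w : Fin k → A.vertices, v = fun j => ↑(w j) :=
  ⟨fun j => ⟨v j, (h.joins j).left_mem⟩, rfl⟩

theorem IsFaceWithBoundary.adj {F : Set X} {k : ℕ} [NeZero k] (hk : k ≠ 1)
    {v : Fin k → A.vertices} {e : Fin k → A.Edge}
    (h : A.IsFaceWithBoundary F (fun j => ↑(v j)) e) (j : Fin k) :
    A.graph.Adj (v j) (v (j + 1)) := by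
  refine ⟨fun hv => ?_, e j, h.joins j⟩
  have hj : j = j + 1 := h.injective_vertex (congrArg Subtype.val hv)
  exact hk (Fin.one_eq_zero_iff.1 (left_eq_add.1 hj))

theorem IsTriangleSaturated.three_dvd_card [Finite ι] (hsat : A.IsTriangleSaturated)
    (hs : A.IsSimple) {S : Finset A.vertices}
    (hS : ∀ u ∈ S, ∀ v, A.graph.Adj u v → v ∈ S) : 3 ∣ #S := by
  classical
  have := hsat.finite_triangles.fintype
  have hface (F : A.triangles) : 3 ∣ #{v ∈ S | ↑v ∈ frontier F.1} := by
    obtain ⟨v, e, h⟩ := F.2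
    obtain ⟨v, rfl⟩ := h.exists_vertex_lift
    have hstep (j : Fin 3) : v j ∈ S ↔ v (j + 1) ∈ S :=
      ⟨fun hj => hS _ hj _ (h.adj (by norm_num) j),
        fun hj => hS _ hj _ (h.adj (by norm_num) j).symm⟩
    have h₁ : v 1 ∈ S ↔ v 0 ∈ S := (hstep 0).symm
    have h₂ : v 2 ∈ S ↔ v 0 ∈ S := hstep 2
    rw [h.card_filter_mem_frontier]
    by_cases h₀ : v 0 ∈ S
    · simp [Finset.filter_true_of_mem, Fin.forall_fin_succ, h₀, h₁, h₂]
    · simp [Finset.filter_false_of_mem, Fin.forall_fin_succ, h₀, h₁, h₂]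
  have hdvd : 3 ∣ 2 * #S :=
    hsat.sum_card_filter_mem_frontier hs S ▸ Finset.dvd_sum fun F _ => hface F
  exact (Nat.Coprime.dvd_mul_left (by norm_num)).1 hdvd

theorem IsTriangleSaturated.cliqueFree_five [Finite ι] (hsat : A.IsTriangleSaturated)
    (hs : A.IsSimple) : A.graph.CliqueFree 5 := by
  intro S hS
  have hdvd := hsat.three_dvd_card hs fun u hu v huv =>
    mem_of_adj_of_isNClique hS (hs.encard_neighborSet_le u) hu huv
  rw [hS.card_eq] at hdvd
  norm_num at hdvd

end Saturation

/-! ### Extensions by one pseudocircle -/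

section Extension

variable {B : PseudocircleArrangement X (Option ι)}

theorem Edge.closedCarrier_subset_support (e : A.Edge) : e.closedCarrier ⊆ A.support := by
  rintro _ ⟨x, -, rfl⟩
  exact mem_iUnion.2 ⟨e.idx, x, rfl⟩

theorem Edge.openCarrier_subset_support (e : A.Edge) : e.openCarrier ⊆ A.support :=
  e.openCarrier_subset_closedCarrier.trans e.closedCarrier_subset_support

theorem vertices_subset_support (A : PseudocircleArrangement X ι) : A.vertices ⊆ A.support := by
  rintro z ⟨i, -, -, hz, -⟩
  exact mem_iUnion.2 ⟨i, hz⟩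

theorem IsFace.subset_compl_support {F : Set X} (h : A.IsFace F) : F ⊆ A.supportᶜ := by
  obtain ⟨x, -, rfl⟩ := h
  exact connectedComponentIn_subset _ _

/-- `B` consists of the pseudocircles of `A` and of one additional pseudocircle, which has the
index `none`. -/
def IsExtension (A : PseudocircleArrangement X ι) (B : PseudocircleArrangement X (Option ι)) :
    Prop :=
  ∀ i, B.curve (some i) = A.curve i

namespace IsExtension

theorem vertices_eq (h : IsExtension A B) :
    B.vertices = A.vertices ∪ A.support ∩ range (B.curve none) := by
  ext z
  constructor
  · rintro ⟨_ | i, _ | j, hij, hi, hj⟩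
    · exact absurd rfl hij
    · exact Or.inr ⟨mem_iUnion.2 ⟨j, h j ▸ hj⟩, hi⟩
    · exact Or.inr ⟨mem_iUnion.2 ⟨i, h i ▸ hi⟩, hj⟩
    · exact Or.inl ⟨i, j, ne_of_apply_ne some hij, h i ▸ hi, h j ▸ hj⟩
  · rintro (⟨i, j, hij, hi, hj⟩ | ⟨hz, hnone⟩)
    · exact ⟨some i, some j, (Option.some_injective ι).ne hij, (h i).symm ▸ hi, (h j).symm ▸ hj⟩
    · obtain ⟨i, hi⟩ := mem_iUnion.1 hz
      exact ⟨some i, none, Option.some_ne_none i, (h i).symm ▸ hi, hnone⟩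

theorem vertices_subset (h : IsExtension A B) : A.vertices ⊆ B.vertices :=
  h.vertices_eq ▸ subset_union_left

/-- The vertices of `A`, as vertices of the extension. -/
def inclusion (h : IsExtension A B) : A.vertices → B.vertices := Set.inclusion h.vertices_subset

theorem curve_none_mem_vertices (h : IsExtension A B) {s : UnitAddCircle}
    (hs : B.curve none s ∈ A.support) : B.curve none s ∈ B.vertices :=
  h.vertices_eq ▸ Or.inr ⟨hs, s, rfl⟩

theorem isSimple (h : IsExtension A B) (hs : A.IsSimple)
    (hd : Disjoint A.vertices (range (B.curve none))) : B.IsSimple := by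
  have hnone {i j : ι} {z : X} (hij : some i ≠ some j) (hi : z ∈ range (B.curve (some i)))
      (hj : z ∈ range (B.curve (some j))) : z ∉ range (B.curve none) :=
    disjoint_left.1 hd ⟨i, j, ne_of_apply_ne some hij, h i ▸ hi, h j ▸ hj⟩
  refine fun i j k hij hjk hik => eq_empty_of_forall_notMem ?_
  rintro z ⟨⟨hi, hj⟩, hk⟩
  rcases i with _ | i <;> rcases j with _ | j <;> rcases k with _ | k <;> try contradiction
  · exact hnone hjk hj hk hi
  · exact hnone hik hi hk hj
  · exact hnone hij hi hj hk
  · rw [h] at hi hj hk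
    exact (hs i j k (ne_of_apply_ne some hij) (ne_of_apply_ne some hjk)
      (ne_of_apply_ne some hik)).le ⟨⟨hi, hj⟩, hk⟩

theorem exists_joins_of_openArc (h : IsExtension A B) {i : ι} {s t : UnitAddCircle}
    (hs : A.curve i s ∈ B.vertices) (ht : A.curve i t ∈ B.vertices)
    (hA : ∀ x ∈ openArc s t, A.curve i x ∉ A.vertices)
    (hB : ∀ x ∈ openArc s t, A.curve i x ∉ range (B.curve none)) :
    ∃ f : B.Edge, f.Joins (A.curve i s) (A.curve i t) := by
  rw [← h i] at hs ht
  refine ⟨⟨some i, s, t, hs, ht, fun x hx hxB => ?_⟩, ?_⟩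
  · rw [h, h.vertices_eq] at hxB
    exact hxB.elim (hA x hx) fun hx' => hB x hx hx'.2
  · exact Or.inl ⟨congrFun (h i) s, congrFun (h i) t⟩

theorem exists_joins_of_disjoint (h : IsExtension A B) {f : A.Edge} {u v : X}
    (hf : f.Joins u v) (hd : Disjoint f.openCarrier (range (B.curve none))) :
    ∃ f' : B.Edge, f'.Joins u v := by
  obtain ⟨f', hf'⟩ := h.exists_joins_of_openArc (h.vertices_subset f.src_mem)
    (h.vertices_subset f.tgt_mem) f.interior_notMem
    fun x hx => disjoint_left.1 hd (mem_image_of_mem _ hx)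
  rcases hf with ⟨rfl, rfl⟩ | ⟨rfl, rfl⟩
  exacts [⟨f', hf'⟩, ⟨f', hf'.symm⟩]

theorem exists_joins_of_inter_eq_singleton (h : IsExtension A B) {f : A.Edge} {u v z : X}
    (hf : f.Joins u v) (hz : f.openCarrier ∩ range (B.curve none) = {z}) :
    (∃ f' : B.Edge, f'.Joins u z) ∧ ∃ f' : B.Edge, f'.Joins v z := by
  obtain ⟨⟨m, hm, rfl⟩, hmB⟩ : z ∈ f.openCarrier ∩ range (B.curve none) := hz ▸ mem_singleton z
  have hmv : A.curve f.idx m ∈ B.vertices :=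
    h.vertices_eq ▸ Or.inr ⟨f.openCarrier_subset_support ⟨m, hm, rfl⟩, hmB⟩
  have hne (x) (hx : x ∈ openArc f.src f.tgt) (hxm : x ≠ m) :
      A.curve f.idx x ∉ range (B.curve none) := fun hxB =>
    hxm (A.injective_curve _ (hz.subset ⟨mem_image_of_mem _ hx, hxB⟩))
  obtain ⟨f₁, h₁⟩ := h.exists_joins_of_openArc (h.vertices_subset f.src_mem) hmv
    (fun x hx => f.interior_notMem x (openArc_subset_left hm hx))
    fun x hx => hne x (openArc_subset_left hm hx) hx.2.2
  obtain ⟨f₂, h₂⟩ := h.exists_joins_of_openArc hmv (h.vertices_subset f.tgt_mem)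
    (fun x hx => f.interior_notMem x (openArc_subset_right hm hx))
    fun x hx => hne x (openArc_subset_right hm hx) hx.2.1
  rcases hf with ⟨rfl, rfl⟩ | ⟨rfl, rfl⟩
  exacts [⟨⟨f₁, h₁⟩, ⟨f₂, h₂.symm⟩⟩, ⟨⟨f₂, h₂.symm⟩, ⟨f₁, h₁⟩⟩]

theorem exists_joins_curve_none (h : IsExtension A B) {s t : UnitAddCircle}
    (hs : B.curve none s ∈ A.support) (ht : B.curve none t ∈ A.support)
    (hst : B.curve none '' openArc s t ⊆ A.supportᶜ) :
    ∃ f : B.Edge, f.Joins (B.curve none s) (B.curve none t) := by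
  refine ⟨⟨none, s, t, h.curve_none_mem_vertices hs, h.curve_none_mem_vertices ht,
    fun x hx hxB => hst (mem_image_of_mem _ hx) ?_⟩, Or.inl ⟨rfl, rfl⟩⟩
  rw [h.vertices_eq] at hxB
  exact hxB.elim (fun hxA => A.vertices_subset_support hxA) And.left

theorem adj_of_adj_inclusion (h : IsExtension A B) {u v : A.vertices}
    (hu : ↑u ∉ range (B.curve none)) (huv : B.graph.Adj (h.inclusion u) (h.inclusion v)) :
    A.graph.Adj u v := by
  obtain ⟨hne, ⟨_ | i, s, t, hs, ht, hst⟩, he⟩ := huv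
  · rcases he with ⟨hsu, -⟩ | ⟨-, htu⟩
    exacts [absurd ⟨s, hsu⟩ hu, absurd ⟨t, htu⟩ hu]
  have hends : A.curve i s ∈ A.vertices ∧ A.curve i t ∈ A.vertices := by
    rw [← h i]
    rcases he with ⟨hsu, htv⟩ | ⟨hsv, htu⟩
    exacts [⟨hsu ▸ u.2, htv ▸ v.2⟩, ⟨hsv ▸ v.2, htu ▸ u.2⟩]
  refine ⟨ne_of_apply_ne _ hne, ⟨i, s, t, hends.1, hends.2, fun x hx hxA => ?_⟩, ?_⟩
  · exact hst x hx (h.vertices_subset ((h i).symm ▸ hxA))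
  · simp only [Edge.Joins, h i] at he
    exact he

theorem cliqueFreeOn (h : IsExtension A B) {n : ℕ} (hA : A.graph.CliqueFree n) :
    B.graph.CliqueFreeOn {v | ↑v ∉ range (B.curve none)} n := by
  classical
  intro S hS hclique
  have hinj : Function.Injective h.inclusion := inclusion_injective h.vertices_subset
  have hrange : ∀ v ∈ S, v ∈ range h.inclusion := fun v hv =>
    ⟨⟨v, (h.vertices_eq.subset v.2).resolve_right fun hv' => hS hv hv'.2⟩, rfl⟩
  refine hA (S.preimage h.inclusion hinj.injOn) ⟨?_, ?_⟩
  · intro u hu v hv huv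
    rw [Finset.mem_coe, Finset.mem_preimage] at hu hv
    exact h.adj_of_adj_inclusion (hS hu) (hclique.isClique hu hv (hinj.ne huv))
  · rw [Finset.card_preimage, Finset.filter_true_of_mem hrange, hclique.card_eq]

end IsExtension

end Extension

/-! ### Coronas -/

section Corona

open scoped Finset

variable {B : PseudocircleArrangement X (Option ι)}

/-- The combinatorial data of a corona extension: the additional pseudocircle of `B` crosses the
edges `a j` and `b j` of the triangles `T j` at the parameters `x j` and `y j` and no other edges.
The pentagon enters only through its edges `e j` and their endpoints `p j`. -/
structure Corona (A : PseudocircleArrangement X ι) (B : PseudocircleArrangement X (Option ι)) where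
  (p q : Fin 5 → A.vertices)
  (e a b : Fin 5 → A.Edge)
  T : Fin 5 → Set X
  (x y : Fin 5 → UnitAddCircle)
  isExtension : A.IsExtension B
  injective_e : Function.Injective e
  disjoint_e : ∀ j, Disjoint (e j).openCarrier (range (B.curve none))
  triangle : ∀ j,
    A.IsFaceWithBoundary (T j) (fun i => ↑(![p j, p (j + 1), q j] i)) ![e j, b j, a j]
  mem_range : ∀ s, B.curve none s ∈ A.support → s ∈ range x ∪ range y
  mem_a : ∀ j, B.curve none (x j) ∈ (a j).openCarrier
  mem_b : ∀ j, B.curve none (y j) ∈ (b j).openCarrier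
  inside : ∀ j, B.curve none '' openArc (x j) (y j) ⊆ A.supportᶜ
  outside : ∀ j, B.curve none '' openArc (y j) (x (j + 1)) ⊆ A.supportᶜ

theorem IsCoronaExtension.nonempty_corona {P : Set X} (h : A.IsCoronaExtension B P) :
    Nonempty (Corona A B) := by
  obtain ⟨hAB, p, q, e, a, b, T, x, y, hP, hT, ⟨z, -, hz, -⟩, -, hs, ha, hb, hin, hout⟩ := h
  obtain ⟨p, rfl⟩ := hP.exists_vertex_lift
  lift q to Fin 5 → A.vertices using fun j => ((hT j).joins 2).left_mem
  refine ⟨⟨p, q, e, a, b, T, x, y, hAB, hP.injective_edge, fun j => ?_, fun j => ?_, hs, ha, hb,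
    fun j => (hin j).trans (hT j).isFace.subset_compl_support, fun j => ?_⟩⟩
  · have hclosure : (e j).openCarrier ⊆ closure P :=
      (hP.openCarrier_subset_iff.2 ⟨j, rfl⟩).trans frontier_subset_closure
    exact disjoint_left.2 fun w hw => connectedComponentIn_subset _ _ (hz (hclosure hw))
  · convert hT j using 2 with i
    fin_cases i <;> rfl
  · obtain ⟨F, hF, -, hsub⟩ := hout j
    exact hsub.trans hF.subset_compl_support

namespace Corona

theorem disjoint_vertices (C : Corona A B) : Disjoint A.vertices (range (B.curve none)) := by
  rw [disjoint_right]
  rintro _ ⟨s, rfl⟩ hs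
  rcases C.mem_range s (A.vertices_subset_support hs) with ⟨j, rfl⟩ | ⟨j, rfl⟩
  exacts [Edge.notMem_vertices_of_mem_openCarrier (C.mem_a j) hs,
    Edge.notMem_vertices_of_mem_openCarrier (C.mem_b j) hs]

theorem isSimple (C : Corona A B) (hs : A.IsSimple) : B.IsSimple :=
  C.isExtension.isSimple hs C.disjoint_vertices

variable (C : Corona A B)

theorem e_subset (j : Fin 5) : (C.e j).openCarrier ⊆ frontier (C.T j) :=
  (C.triangle j).openCarrier_subset_iff.2 ⟨0, rfl⟩

theorem b_subset (j : Fin 5) : (C.b j).openCarrier ⊆ frontier (C.T j) :=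
  (C.triangle j).openCarrier_subset_iff.2 ⟨1, rfl⟩

theorem a_subset (j : Fin 5) : (C.a j).openCarrier ⊆ frontier (C.T j) :=
  (C.triangle j).openCarrier_subset_iff.2 ⟨2, rfl⟩

theorem a_ne_e (j k : Fin 5) : C.a j ≠ C.e k := fun h =>
  disjoint_left.1 (C.disjoint_e k) (h ▸ C.mem_a j) ⟨C.x j, rfl⟩

theorem b_ne_e (j k : Fin 5) : C.b j ≠ C.e k := fun h =>
  disjoint_left.1 (C.disjoint_e k) (h ▸ C.mem_b j) ⟨C.y j, rfl⟩

theorem isPolygonalFace (j : Fin 5) : A.IsPolygonalFace 3 (C.T j) := ⟨_, _, C.triangle j⟩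

theorem injective_T : Function.Injective C.T := by
  intro j k hjk
  obtain ⟨l, hl⟩ := (C.triangle j).openCarrier_subset_iff.1 (hjk ▸ C.e_subset k)
  fin_cases l
  exacts [C.injective_e hl, absurd hl (C.b_ne_e j k), absurd hl (C.a_ne_e j k)]

theorem eq_of_subset (hsat : A.IsTriangleSaturated) {f : A.Edge} {j k : Fin 5}
    (hj : f.openCarrier ⊆ frontier (C.T j)) (hk : f.openCarrier ⊆ frontier (C.T k)) : j = k :=
  C.injective_T ((hsat f).unique ⟨C.isPolygonalFace j, hj⟩ ⟨C.isPolygonalFace k, hk⟩)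

theorem injective_a (hsat : A.IsTriangleSaturated) : Function.Injective C.a := fun j k hjk =>
  C.eq_of_subset hsat (C.a_subset j) (hjk ▸ C.a_subset k)

theorem injective_b (hsat : A.IsTriangleSaturated) : Function.Injective C.b := fun j k hjk =>
  C.eq_of_subset hsat (C.b_subset j) (hjk ▸ C.b_subset k)

theorem a_ne_b (hsat : A.IsTriangleSaturated) (j k : Fin 5) : C.a j ≠ C.b k := by
  intro hjk
  obtain rfl := C.eq_of_subset hsat (C.a_subset j) (hjk ▸ C.b_subset k)
  exact absurd ((C.triangle j).injective_edge (a₁ := 2) (a₂ := 1) hjk) (by decide)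

theorem eq_of_mem_openCarrier {f : A.Edge} {s : UnitAddCircle}
    (hs : B.curve none s ∈ f.openCarrier) :
    (∃ j, s = C.x j ∧ f = C.a j) ∨ ∃ j, s = C.y j ∧ f = C.b j := by
  have hs' := f.openCarrier_subset_closedCarrier hs
  rcases C.mem_range s (f.closedCarrier_subset_support hs') with ⟨j, rfl⟩ | ⟨j, rfl⟩
  · exact Or.inl ⟨j, rfl,
      (Edge.eq_of_mem_openCarrier_of_mem_closedCarrier (C.mem_a j) hs').symm⟩
  · exact Or.inr ⟨j, rfl,
      (Edge.eq_of_mem_openCarrier_of_mem_closedCarrier (C.mem_b j) hs').symm⟩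

theorem a_inter_range (hsat : A.IsTriangleSaturated) (j : Fin 5) :
    (C.a j).openCarrier ∩ range (B.curve none) = {B.curve none (C.x j)} := by
  refine Subset.antisymm ?_ (singleton_subset_iff.2 ⟨C.mem_a j, C.x j, rfl⟩)
  rintro _ ⟨hs, s, rfl⟩
  rcases C.eq_of_mem_openCarrier hs with ⟨k, rfl, hk⟩ | ⟨k, -, hk⟩
  · rw [C.injective_a hsat hk, mem_singleton_iff]
  · exact absurd hk (C.a_ne_b hsat j k)

theorem b_inter_range (hsat : A.IsTriangleSaturated) (j : Fin 5) :
    (C.b j).openCarrier ∩ range (B.curve none) = {B.curve none (C.y j)} := by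
  refine Subset.antisymm ?_ (singleton_subset_iff.2 ⟨C.mem_b j, C.y j, rfl⟩)
  rintro _ ⟨hs, s, rfl⟩
  rcases C.eq_of_mem_openCarrier hs with ⟨k, -, hk⟩ | ⟨k, rfl, hk⟩
  · exact absurd hk.symm (C.a_ne_b hsat k j)
  · rw [C.injective_b hsat hk, mem_singleton_iff]

theorem x_mem_support (j : Fin 5) : B.curve none (C.x j) ∈ A.support :=
  (C.a j).openCarrier_subset_support (C.mem_a j)

theorem y_mem_support (j : Fin 5) : B.curve none (C.y j) ∈ A.support :=
  (C.b j).openCarrier_subset_support (C.mem_b j)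

/-- The vertices of `A`, as vertices of `B`. -/
def oldVertex : A.vertices → B.vertices := C.isExtension.inclusion

/-- The vertex of `B` at which the additional pseudocircle crosses the edge `a j`. -/
def vertexX (j : Fin 5) : B.vertices :=
  ⟨B.curve none (C.x j), C.isExtension.curve_none_mem_vertices (C.x_mem_support j)⟩

/-- The vertex of `B` at which the additional pseudocircle crosses the edge `b j`. -/
def vertexY (j : Fin 5) : B.vertices :=
  ⟨B.curve none (C.y j), C.isExtension.curve_none_mem_vertices (C.y_mem_support j)⟩

theorem injective_vertexX (hsat : A.IsTriangleSaturated) : Function.Injective C.vertexX := by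
  intro j k hjk
  have hval : B.curve none (C.x j) = B.curve none (C.x k) := congrArg Subtype.val hjk
  exact C.injective_a hsat (Edge.eq_of_mem_openCarrier_of_mem_closedCarrier (C.mem_a j)
    ((C.a k).openCarrier_subset_closedCarrier (hval ▸ C.mem_a k)))

theorem injective_vertexY (hsat : A.IsTriangleSaturated) : Function.Injective C.vertexY := by
  intro j k hjk
  have hval : B.curve none (C.y j) = B.curve none (C.y k) := congrArg Subtype.val hjk
  exact C.injective_b hsat (Edge.eq_of_mem_openCarrier_of_mem_closedCarrier (C.mem_b j)
    ((C.b k).openCarrier_subset_closedCarrier (hval ▸ C.mem_b k)))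

theorem vertexX_ne_vertexY (hsat : A.IsTriangleSaturated) (j k : Fin 5) :
    C.vertexX j ≠ C.vertexY k := by
  intro hjk
  have hval : B.curve none (C.x j) = B.curve none (C.y k) := congrArg Subtype.val hjk
  exact C.a_ne_b hsat j k (Edge.eq_of_mem_openCarrier_of_mem_closedCarrier (C.mem_a j)
    ((C.b k).openCarrier_subset_closedCarrier (hval ▸ C.mem_b k)))

theorem oldVertex_ne_vertexX (v : A.vertices) (j : Fin 5) : C.oldVertex v ≠ C.vertexX j := fun h =>
  disjoint_left.1 C.disjoint_vertices v.2 ⟨C.x j, (congrArg Subtype.val h).symm⟩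

theorem oldVertex_ne_vertexY (v : A.vertices) (j : Fin 5) : C.oldVertex v ≠ C.vertexY j := fun h =>
  disjoint_left.1 C.disjoint_vertices v.2 ⟨C.y j, (congrArg Subtype.val h).symm⟩

theorem mem_range_vertexX_or_vertexY {u : B.vertices} (hu : ↑u ∈ range (B.curve none)) :
    u ∈ range C.vertexX ∨ u ∈ range C.vertexY := by
  obtain ⟨s, hs⟩ := hu
  have hsA : B.curve none s ∈ A.support := by
    rw [hs]
    rcases C.isExtension.vertices_eq.subset u.2 with h | h
    exacts [absurd ⟨s, hs⟩ (disjoint_left.1 C.disjoint_vertices h), h.1]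
  rcases C.mem_range s hsA with ⟨j, rfl⟩ | ⟨j, rfl⟩
  exacts [Or.inl ⟨j, Subtype.ext hs⟩, Or.inr ⟨j, Subtype.ext hs⟩]

theorem adj_oldVertex_of_disjoint {u v : A.vertices} (huv : u ≠ v) {f : A.Edge} (hf : f.Joins u v)
    (hd : Disjoint f.openCarrier (range (B.curve none))) :
    B.graph.Adj (C.oldVertex u) (C.oldVertex v) :=
  ⟨(inclusion_injective C.isExtension.vertices_subset).ne huv,
    C.isExtension.exists_joins_of_disjoint hf hd⟩

theorem adj_vertexX_vertexY (hsat : A.IsTriangleSaturated) (j : Fin 5) :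
    B.graph.Adj (C.vertexX j) (C.vertexY j) :=
  ⟨C.vertexX_ne_vertexY hsat j j, C.isExtension.exists_joins_curve_none (C.x_mem_support j)
    (C.y_mem_support j) (C.inside j)⟩

theorem adj_vertexY_vertexX (hsat : A.IsTriangleSaturated) (j : Fin 5) :
    B.graph.Adj (C.vertexY j) (C.vertexX (j + 1)) :=
  ⟨(C.vertexX_ne_vertexY hsat (j + 1) j).symm, C.isExtension.exists_joins_curve_none
    (C.y_mem_support j) (C.x_mem_support (j + 1)) (C.outside j)⟩

theorem p_ne_p (j : Fin 5) : C.p j ≠ C.p (j + 1) := fun h =>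
  absurd ((C.triangle j).injective_vertex (a₁ := 0) (a₂ := 1) (congrArg Subtype.val h)) (by decide)

theorem adj_p_p (j : Fin 5) : B.graph.Adj (C.oldVertex (C.p j)) (C.oldVertex (C.p (j + 1))) :=
  C.adj_oldVertex_of_disjoint (C.p_ne_p j) ((C.triangle j).joins 0) (C.disjoint_e j)

theorem adj_p_vertexX (hsat : A.IsTriangleSaturated) (j : Fin 5) :
    B.graph.Adj (C.oldVertex (C.p j)) (C.vertexX j) :=
  ⟨C.oldVertex_ne_vertexX _ j, (C.isExtension.exists_joins_of_inter_eq_singleton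
    ((C.triangle j).joins 2) (C.a_inter_range hsat j)).2⟩

theorem adj_q_vertexX (hsat : A.IsTriangleSaturated) (j : Fin 5) :
    B.graph.Adj (C.oldVertex (C.q j)) (C.vertexX j) :=
  ⟨C.oldVertex_ne_vertexX _ j, (C.isExtension.exists_joins_of_inter_eq_singleton
    ((C.triangle j).joins 2) (C.a_inter_range hsat j)).1⟩

theorem adj_p_vertexY (hsat : A.IsTriangleSaturated) (j : Fin 5) :
    B.graph.Adj (C.oldVertex (C.p (j + 1))) (C.vertexY j) :=
  ⟨C.oldVertex_ne_vertexY _ j, (C.isExtension.exists_joins_of_inter_eq_singleton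
    ((C.triangle j).joins 1) (C.b_inter_range hsat j)).1⟩

theorem adj_q_vertexY (hsat : A.IsTriangleSaturated) (j : Fin 5) :
    B.graph.Adj (C.oldVertex (C.q j)) (C.vertexY j) :=
  ⟨C.oldVertex_ne_vertexY _ j, (C.isExtension.exists_joins_of_inter_eq_singleton
    ((C.triangle j).joins 1) (C.b_inter_range hsat j)).2⟩

theorem ten_le_card (C : Corona A B) (hsat : A.IsTriangleSaturated) {S : Finset B.vertices}
    (hS : ∀ u ∈ S, ∀ v, B.graph.Adj u v → v ∈ S) {u : B.vertices} (huS : u ∈ S)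
    (hu : ↑u ∈ range (B.curve none)) : 10 ≤ #S := by
  have hXY (j) (hj : C.vertexX j ∈ S) : C.vertexY j ∈ S := hS _ hj _ (C.adj_vertexX_vertexY hsat j)
  have hYX (j) (hj : C.vertexY j ∈ S) : C.vertexX (j + 1) ∈ S :=
    hS _ hj _ (C.adj_vertexY_vertexX hsat j)
  have hX : ∀ j, C.vertexX j ∈ S := by
    rcases C.mem_range_vertexX_or_vertexY hu with ⟨j, rfl⟩ | ⟨j, rfl⟩
    · exact forall_fin_of_add_one (fun k hk => hYX k (hXY k hk)) huS
    · exact forall_fin_of_add_one (fun k hk => hYX k (hXY k hk)) (hYX j huS)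
  have hinj : Function.Injective (Sum.elim C.vertexX C.vertexY) :=
    (C.injective_vertexX hsat).sumElim (C.injective_vertexY hsat) (C.vertexX_ne_vertexY hsat)
  simpa using Finset.card_le_card_of_injOn (s := Finset.univ) _
    (fun k _ => k.rec hX fun j => hXY j (hX j)) hinj.injOn

theorem cliqueFree_five [Finite ι] (C : Corona A B) (hs : A.IsSimple)
    (hsat : A.IsTriangleSaturated) : B.graph.CliqueFree 5 := by
  intro S hS
  by_cases hγ : ∃ u ∈ S, ↑u ∈ range (B.curve none)
  · obtain ⟨u, huS, hu⟩ := hγ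
    have hten : 10 ≤ #S := C.ten_le_card hsat (fun v hv w hvw =>
      mem_of_adj_of_isNClique hS ((C.isSimple hs).encard_neighborSet_le v) hv hvw) huS hu
    rw [hS.card_eq] at hten
    norm_num at hten
  · push Not at hγ
    exact C.isExtension.cliqueFreeOn (hsat.cliqueFree_five hs) hγ hS

theorem colorable_four [Finite ι] (C : Corona A B) (hs : A.IsSimple)
    (hsat : A.IsTriangleSaturated) : B.graph.Colorable 4 := by
  exact colorable_of_cliqueFree_succ (by norm_num) (C.isSimple hs).encard_neighborSet_le
    (C.cliqueFree_five hs hsat)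

theorem disjoint_of_notMem_range (hsat : A.IsTriangleSaturated) {F : Set X} {v : Fin 3 → X}
    {e : Fin 3 → A.Edge} (h : A.IsFaceWithBoundary F v e) (hF : F ∉ range C.T) (j : Fin 3) :
    Disjoint (e j).openCarrier (range (B.curve none)) := by
  have heF : (e j).openCarrier ⊆ frontier F := h.openCarrier_subset_iff.2 ⟨j, rfl⟩
  have hne (k) (hk : (e j).openCarrier ⊆ frontier (C.T k)) : False :=
    hF ⟨k, (hsat (e j)).unique ⟨C.isPolygonalFace k, hk⟩ ⟨⟨v, e, h⟩, heF⟩⟩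
  refine disjoint_left.2 ?_
  rintro _ hz ⟨s, rfl⟩
  rcases C.eq_of_mem_openCarrier hz with ⟨k, -, hk⟩ | ⟨k, -, hk⟩
  exacts [hne k (hk ▸ C.a_subset k), hne k (hk ▸ C.b_subset k)]

open Classical in
theorem card_filter_mem_frontier (j : Fin 5) (S : Finset A.vertices) :
    #{v ∈ S | ↑v ∈ frontier (C.T j)} =
      (if C.p j ∈ S then 1 else 0) + (if C.p (j + 1) ∈ S then 1 else 0) +
        if C.q j ∈ S then 1 else 0 := by
  rw [(C.triangle j).card_filter_mem_frontier (v := ![C.p j, C.p (j + 1), C.q j]),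
    Finset.card_filter, Fin.sum_univ_three]
  rfl

open Classical in
theorem card_filter_mem_frontier_of_notMem_range [Fintype A.vertices] (hsat : A.IsTriangleSaturated)
    (c : B.graph.Coloring (Fin 3)) (i : Fin 3) {F : Set X} (hF : F ∈ A.triangles)
    (hFT : F ∉ range C.T) :
    #{v ∈ ({v | c (C.oldVertex v) = i} : Finset A.vertices) | ↑v ∈ frontier F} = 1 := by
  obtain ⟨v, e, h⟩ := hF
  obtain ⟨v, rfl⟩ := h.exists_vertex_lift
  have hc (j) : c (C.oldVertex (v j)) ≠ c (C.oldVertex (v (j + 1))) :=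
    c.valid (C.adj_oldVertex_of_disjoint (h.adj (by norm_num) j).ne (h.joins j)
      (C.disjoint_of_notMem_range hsat h hFT j))
  rw [h.card_filter_mem_frontier, Finset.card_filter, Fin.sum_univ_three]
  simp only [Finset.mem_filter_univ]
  exact ite_add_ite_add_ite_eq_one (hc 0) (hc 1) (hc 2) i

/-- The triangles `T j`, as triangular faces of `A`. -/
def toTriangles : Fin 5 ↪ A.triangles :=
  ⟨fun j => ⟨C.T j, C.isPolygonalFace j⟩, fun _ _ hjk => C.injective_T (congrArg Subtype.val hjk)⟩

theorem exists_forall_even_add_colorCount [Finite ι] (hs : A.IsSimple)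
    (hsat : A.IsTriangleSaturated) (c : B.graph.Coloring (Fin 3)) :
    ∃ N, ∀ i, Even (N + colorCount (fun j => c (C.oldVertex (C.q j))) i) := by
  classical
  have := A.finite_vertices.fintype
  have := hsat.finite_triangles.fintype
  refine ⟨#(Finset.univ.map C.toTriangles)ᶜ, fun i => ?_⟩
  set S : Finset A.vertices := {v | c (C.oldVertex v) = i} with hS
  have hcorona : ∑ F ∈ Finset.univ.map C.toTriangles, #{v ∈ S | ↑v ∈ frontier F.1} =
      2 * colorCount (fun j => c (C.oldVertex (C.p j))) i +
        colorCount (fun j => c (C.oldVertex (C.q j))) i := by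
    have hshift := colorCount_comp_add_one (fun j => c (C.oldVertex (C.p j))) i
    rw [two_mul]
    nth_rw 2 [← hshift]
    rw [Finset.sum_map]
    refine (Finset.sum_congr rfl fun j _ => C.card_filter_mem_frontier j S).trans ?_
    simp only [hS, Finset.mem_filter_univ, colorCount_eq_sum, Finset.sum_add_distrib]
  have hrest : ∑ F ∈ (Finset.univ.map C.toTriangles)ᶜ, #{v ∈ S | ↑v ∈ frontier F.1} =
      #(Finset.univ.map C.toTriangles)ᶜ := by
    rw [Finset.card_eq_sum_ones]
    refine Finset.sum_congr rfl fun F hF =>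
      C.card_filter_mem_frontier_of_notMem_range hsat c i F.2 ?_
    rintro ⟨j, hj⟩
    exact Finset.mem_compl.1 hF (Finset.mem_map.2 ⟨j, Finset.mem_univ j, Subtype.ext hj⟩)
  have htotal := hsat.sum_card_filter_mem_frontier hs S
  rw [← Finset.sum_add_sum_compl (Finset.univ.map C.toTriangles), hcorona, hrest] at htotal
  rw [Nat.even_iff]
  lia

theorem not_colorable_three [Finite ι] (C : Corona A B) (hs : A.IsSimple)
    (hsat : A.IsTriangleSaturated) : ¬ B.graph.Colorable 3 := by
  rintro ⟨c⟩
  obtain ⟨N, hN⟩ := C.exists_forall_even_add_colorCount hs hsat c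
  have hpq := colorCount_eq_of_cap_of_ring (fun j => c.valid (C.adj_p_vertexX hsat j))
    (fun j => c.valid (C.adj_p_vertexY hsat j)) (fun j => c.valid (C.adj_q_vertexX hsat j))
    (fun j => c.valid (C.adj_q_vertexY hsat j)) (fun j => c.valid (C.adj_vertexX_vertexY hsat j))
    fun j => c.valid (C.adj_vertexY_vertexX hsat j)
  exact not_forall_even_add_colorCount (fun j => c.valid (C.adj_p_p j)) N fun i => hpq i ▸ hN i

end Corona

end Corona

end PseudocircleArrangement

theorem mainTheorem7_general {X : Type*} [TopologicalSpace X] {ι : Type*} [Finite ι]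
    (A : PseudocircleArrangement X ι) (hsimple : A.IsSimple) (hsat : A.IsTriangleSaturated)
    (P : Set X) (B : PseudocircleArrangement X (Option ι)) (hB : A.IsCoronaExtension B P) :
    B.graph.chromaticNumber = 4 := by
  obtain ⟨C⟩ := hB.nonempty_corona
  exact SimpleGraph.chromaticNumber_eq_iff_colorable_not_colorable.2
    ⟨C.colorable_four hsimple hsat, C.not_colorable_three hsimple hsat⟩

theorem mainTheorem7 {X : Type*} [TopologicalSpace X] (hX : IsSphereOrPlane X)
    {ι : Type*} [Finite ι] (A : PseudocircleArrangement X ι)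
    (hsimple : A.IsSimple) (hsat : A.IsTriangleSaturated)
    (P : Set X) (hP : A.IsPolygonalFace 5 P)
    (B : PseudocircleArrangement X (Option ι)) (hB : A.IsCoronaExtension B P) :
    B.graph.chromaticNumber = 4 :=
  mainTheorem7_general A hsimple hsat P B hB
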